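/- **Setting.** Let $X=(X_i)_{i\in\mathbb N}$ be real random variables, $Y$ a real random variable with $\mathbb E[Y^2]<\infty$, and $Z$ a random variable with values in the finite set $E=\{1,\dots,K\}$, such that $\mathbb P(Z=z)>0$ for all $z\in E$ and $X_1,X_2,\dots$ are conditionally independent given $Z=z$ with finite conditional second moments, conditional means $\mu_i(z)=\mathbb E[X_i\mid Z=z]$ and conditional variances $\sigma_i^2(z)=\operatorname{Var}[X_i\mid Z=z]$. Assume that $\sum_{i=1}^\infty(\mu_i(z)-\mu_i(v))^2=\infty$ for all $z\neq v$, and that there are constants $0<\sigma_{\min}^2\le\sigma_{\max}^2<\infty$ with $\sigma_{\min}^2\le\max_{z\in E}\sigma_i^2(z)\le\sigma_{\max}^2$ for all $i$. Write $X_{1:p}=(X_1,\dots,X_p)$, $\mu_{1:p}(z)=(\mu_1(z),\dots,\mu_p(z))$, $g(z)=\mathbb E[Y\mid Z=z]$ and $\mathrm{sep}(p)=\min_{z\ne v}\|\mu_{1:p}(z)-\mu_{1:p}(v)\|_2^2$ (with $\mathrm{sep}(p)=\infty$ if $K=1$). Fix $i$ and let $$\beta_i=\frac{\mathbb E[\operatorname{Cov}[X_i,Y\mid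 Z]]}{\mathbb E[\operatorname{Var}[X_i\mid Z]]}.$$ **Data and estimators.** Let $\mathcal S_0$ consist of $m$ i.i.d. observations of $X_{1:p}$, let $(x_{1:p,k},z_k,y_k)$, $k=1,\dots,n$, be i.i.d. observations of $(X_{1:p},Z,Y)$, independent of $\mathcal S_0$, and let $\mathcal S=\{(x_{1:p,k},y_k)\}_{k\le n}$ be the observed part; let $p\ge i$. Let $\check\mu_{1:p}(z)\in\mathbb R^p$, $z\in E$, be any measurable functions of $\mathcal S_0$, and put $$R^{(p)}_{z,v}=\frac{\|\mu_{1:p}(z)-\check\mu_{1:p}(z)\|_2}{\|\mu_{1:p}(z)-\mu_{1:p}(v)\|_2}\quad(v\ne z),\qquad \hat z_k=\operatorname*{arg\,min}_{z\in E}\|x_{1:p,k}-\check\mu_{1:p}(z)\|_2,$$ with ties broken by an arbitrary fixed measurable rule. For labels $\ell_1,\dots,\ell_n\in E$ let $\bar x_i^{\ell}(z)$ and $\bar y^{\ell}(z)$ be the averages of $x_{i,k}$ and $y_k$ over those $k$ with $\ell_k=z$, and let $$b(\ell)=\frac{\sum_{k=1}^n(x_{i,k}-\bar x_i^{\ell}(\ell_k))(y_k-\bar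 y^{\ell}(\ell_k))}{\sum_{k=1}^n(x_{i,k}-\bar x_i^{\ell}(\ell_k))^2}$$ (with value $0$ if the denominator is $0$). The substitute adjustment estimator is $\hat\beta_i^{\mathrm{sub}}=b(\hat z_1,\dots,\hat z_n)$ and the oracle least squares estimator is $\hat\beta_i=b(z_1,\dots,z_n)$. **Theorem.** Let $n,m,p\to\infty$ such that $\mathbb P(R^{(p)}_{z,v}>\tfrac1{10})\to0$ for all $z\ne v$. Then: 1. $|\hat\beta_i^{\mathrm{sub}}-\hat\beta_i|\to0$ in probability, and $\hat\beta_i^{\mathrm{sub}}\to\beta_i$ in probability. 2. If $\mathrm{sep}(p)/n\to\infty$ and $n\,\mathbb P(R^{(p)}_{z,v}>\tfrac1{10})\to0$ for all $z\ne v$, then $\sqrt n\,|\hat\beta_i^{\mathrm{sub}}-\hat\beta_i|\to0$ in probability. 3. If there is a constant $c\ge 0$ with $\mathbb E[e^{\lambda(X_j-\mu_j(z))}\mid Z=z]\le e^{c\lambda^2/2}$ for all $\lambda\in\mathbb R$, $j\in\mathbb N$ and $z\in E$, and if $\mathrm{sep}(p)/\log n\to\infty$ and $n\,\mathbb P(R^{(p)}_{z,v}>\tfrac1{10})\to0$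 for all $z\ne v$, then $\sqrt n\,|\hat\beta_i^{\mathrm{sub}}-\hat\beta_i|\to0$ in probability. In addition, in case 2 as well as in case 3, for every $w^2\ge0$, $\sqrt n(\hat\beta_i-\beta_i)\to\mathcal N(0,w^2)$ in distribution if and only if $\sqrt n(\hat\beta_i^{\mathrm{sub}}-\beta_i)\to\mathcal N(0,w^2)$ in distribution. If moreover, with $\xi=X_i-\mu_i(Z)$ and $\varepsilon=Y-g(Z)-\beta_i\xi$, one has $\mathbb E[\xi^2\varepsilon^2]<\infty$, then both convergences hold with the sandwich variance $$w^2=w_i^2=\frac{\mathbb E[\xi^2\varepsilon^2]}{\big(\mathbb E[\operatorname{Var}[X_i\mid Z]]\big)^2}.$$ -/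

import Mathlib

open MeasureTheory ProbabilityTheory Filter Topology
open scoped ENNReal NNReal

noncomputable section

namespace SubstituteAdjustment

/-! ### The mixture model

Coordinates `X₁, X₂, …` are indexed by `ℕ` starting from `0`, so that the first `p` coordinates
are indexed by `Fin p`; the latent set `{1, …, K}` is `Fin K`. -/

section Model

variable {Ω : Type*} [MeasurableSpace Ω] {K : ℕ}

/-- The conditional mean `μ_i(z) = E[X_i | Z = z]`. -/
def condMean (P : Measure Ω) (X : ℕ → Ω → ℝ) (Z : Ω → Fin K) (i : ℕ) (z : Fin K) : ℝ :=
  ∫ ω, X i ω ∂(P[|Z ← z])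

/-- The conditional variance `σ_i²(z) = Var[X_i | Z = z]`. -/
def condVariance (P : Measure Ω) (X : ℕ → Ω → ℝ) (Z : Ω → Fin K) (i : ℕ) (z : Fin K) : ℝ :=
  Var[X i; P[|Z ← z]]

/-- The conditional covariance `Cov[X_i, Y | Z = z]`. -/
def condCovariance (P : Measure Ω) (X : ℕ → Ω → ℝ) (Z : Ω → Fin K) (Y : Ω → ℝ) (i : ℕ)
    (z : Fin K) : ℝ :=
  cov[X i, Y; P[|Z ← z]]

/-- The conditional mean `g(z) = E[Y | Z = z]`. -/
def outcomeMean (P : Measure Ω) (Z : Ω → Fin K) (Y : Ω → ℝ) (z : Fin K) : ℝ :=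
  ∫ ω, Y ω ∂(P[|Z ← z])

/-- The finite mixture model: given `Z = z` the variables `X₁, X₂, …` are independent with finite
second moments, the vectors of conditional means are separated, the (maximal) conditional
variances are bounded from above and away from zero, and every component has positive weight. -/
structure IsMixtureModel (P : Measure Ω) (X : ℕ → Ω → ℝ) (Z : Ω → Fin K) : Prop where
  measurable_X : ∀ i, Measurable (X i)
  measurable_Z : Measurable Z
  condIndep : ∀ z, iIndepFun X (P[|Z ← z])
  memLp_two : ∀ i z, MemLp (X i) 2 (P[|Z ← z])
  separation : ∀ z v, v ≠ z →
    ∑' i, ENNReal.ofReal ((condMean P X Z i z - condMean P X Z i v) ^ 2) = ⊤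
  variance_bounds : ∃ sMin sMax : ℝ, 0 < sMin ∧ sMin ≤ sMax ∧
    ∀ i, sMin ≤ ⨆ z, condVariance P X Z i z ∧ ⨆ z, condVariance P X Z i z ≤ sMax
  weight_pos : ∀ z, 0 < P (Z ⁻¹' {z})

/-- `X_i` given `Z = z` is sub-Gaussian, with one variance factor for all `i` and `z`. -/
def IsUniformlySubGaussian (P : Measure Ω) (X : ℕ → Ω → ℝ) (Z : Ω → Fin K) : Prop :=
  ∃ c : ℝ≥0, ∀ i z, HasSubgaussianMGF (fun ω => X i ω - condMean P X Z i z) c (P[|Z ← z])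

/-- `E[Var[X_i | Z]]`. -/
def meanCondVariance (P : Measure Ω) (X : ℕ → Ω → ℝ) (Z : Ω → Fin K) (i : ℕ) : ℝ :=
  ∫ ω, condVariance P X Z i (Z ω) ∂P

/-- The target parameter `β_i = E[Cov[X_i, Y | Z]] / E[Var[X_i | Z]]`. -/
def targetBeta (P : Measure Ω) (X : ℕ → Ω → ℝ) (Z : Ω → Fin K) (Y : Ω → ℝ) (i : ℕ) : ℝ :=
  (∫ ω, condCovariance P X Z Y i (Z ω) ∂P) / meanCondVariance P X Z i

/-- The score `(X_i - μ_i(Z)) (Y - g(Z) - β_i (X_i - μ_i(Z)))` of the least squares problem. -/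
def olsScore (P : Measure Ω) (X : ℕ → Ω → ℝ) (Z : Ω → Fin K) (Y : Ω → ℝ) (i : ℕ) (ω : Ω) : ℝ :=
  (X i ω - condMean P X Z i (Z ω)) *
    (Y ω - outcomeMean P Z Y (Z ω)
      - targetBeta P X Z Y i * (X i ω - condMean P X Z i (Z ω)))

/-- The sandwich formula for the asymptotic variance parameter `w_i²` of the oracle least squares
estimator. -/
def sandwichVariance (P : Measure Ω) (X : ℕ → Ω → ℝ) (Z : Ω → Fin K) (Y : Ω → ℝ) (i : ℕ) : ℝ :=
  (∫ ω, olsScore P X Z Y i ω ^ 2 ∂P) / meanCondVariance P X Z i ^ 2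

/-- The vector `μ_{1:p}(z)`. -/
def meanVec (P : Measure Ω) (X : ℕ → Ω → ℝ) (Z : Ω → Fin K) (p : ℕ) (z : Fin K) : Fin p → ℝ :=
  fun j => condMean P X Z j z

end Model

/-! ### Separation, relative errors and the estimators -/

/-- The Euclidean distance on `ℝ^p`. -/
def dist2 {p : ℕ} (a b : Fin p → ℝ) : ℝ := ‖WithLp.toLp 2 (a - b)‖

/-- The minimal `p`-separation `sep(p) = min_{z ≠ v} ‖μ_{1:p}(z) - μ_{1:p}(v)‖²`, which is `⊤` (the
minimum over the empty set) if there is only one component. -/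
def sep {Ω : Type*} [MeasurableSpace Ω] {K : ℕ} (P : Measure Ω) (X : ℕ → Ω → ℝ) (Z : Ω → Fin K)
    (p : ℕ) : ℝ≥0∞ :=
  ⨅ (z : Fin K) (v : Fin K) (_ : v ≠ z),
    ENNReal.ofReal (dist2 (meanVec P X Z p z) (meanVec P X Z p v) ^ 2)

/-- The relative error `R_{z,v}` of the vectors `muCheck` as approximations of `mu`. -/
def relError {K p : ℕ} (mu muCheck : Fin K → Fin p → ℝ) (z v : Fin K) : ℝ :=
  dist2 (mu z) (muCheck z) / dist2 (mu z) (mu v)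

/-- A measurable rule that picks, for every vector `d`, an index at which `d` is minimal (that is,
an `argmin` with an arbitrary measurable way to break ties). -/
def IsArgminRule {K : ℕ} (sel : (Fin K → ℝ) → Fin K) : Prop :=
  Measurable sel ∧ ∀ (d : Fin K → ℝ) (v : Fin K), d (sel d) ≤ d v

/-- The substitute `argmin_z ‖x - muCheck(z)‖` of the latent variable. -/
def substitute {K p : ℕ} (sel : (Fin K → ℝ) → Fin K) (muCheck : Fin K → Fin p → ℝ)
    (x : Fin p → ℝ) : Fin K :=
  sel (fun z => dist2 x (muCheck z))

/-- The average of the `a k` over those `k` that carry the label `v`. -/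
def groupMean {K n : ℕ} (label : Fin n → Fin K) (a : Fin n → ℝ) (v : Fin K) : ℝ :=
  (∑ k with label k = v, a k) / (Finset.card {k | label k = v} : ℝ)

/-- The least squares coefficient of `x` when `y` is regressed on `x` and the labels. -/
def betaOLS {K n : ℕ} (label : Fin n → Fin K) (x y : Fin n → ℝ) : ℝ :=
  (∑ k, (x k - groupMean label x (label k)) * (y k - groupMean label y (label k))) /
    ∑ k, (x k - groupMean label x (label k)) ^ 2

/-- The substitute adjustment estimator computed from the estimated component means `muCheck` and
the data `(xs k, y k)`, `k = 1, …, n`. -/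
def betaSub {K n p : ℕ} (sel : (Fin K → ℝ) → Fin K) (muCheck : Fin K → Fin p → ℝ)
    (xs : Fin n → Fin p → ℝ) (y : Fin n → ℝ) (i : Fin p) : ℝ :=
  betaOLS (fun k => substitute sel muCheck (xs k)) (fun k => xs k i) y

/-- The oracle estimator, which uses the latent variables `z k`. -/
def betaOracle {K n p : ℕ} (z : Fin n → Fin K) (xs : Fin n → Fin p → ℝ) (y : Fin n → ℝ)
    (i : Fin p) : ℝ :=
  betaOLS z (fun k => xs k i) y

/-- The data: `xs₀` consists of `m` i.i.d. observations of `X_{1:p}`, the triples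
`(xs k, z k, y k)` are `n` i.i.d. observations of `(X_{1:p}, Z, Y)`, and the two datasets are
independent. -/
structure IsData {Ω₀ Ω : Type*} [MeasurableSpace Ω₀] [MeasurableSpace Ω] {K : ℕ}
    (P : Measure Ω₀) (X : ℕ → Ω₀ → ℝ) (Z : Ω₀ → Fin K) (Y : Ω₀ → ℝ)
    (Q : Measure Ω) (n m p : ℕ) (xs₀ : Fin m → Ω → Fin p → ℝ)
    (xs : Fin n → Ω → Fin p → ℝ) (z : Fin n → Ω → Fin K) (y : Fin n → Ω → ℝ) : Prop where
  identDistrib₀ : ∀ k, IdentDistrib (xs₀ k) (fun ω (j : Fin p) => X j ω) Q P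
  indep₀ : iIndepFun xs₀ Q
  identDistrib : ∀ k, IdentDistrib (fun ω => (xs k ω, z k ω, y k ω))
    (fun ω => ((fun j : Fin p => X j ω), Z ω, Y ω)) Q P
  indep : iIndepFun (fun k ω => (xs k ω, z k ω, y k ω)) Q
  indepFun : IndepFun (fun ω k => xs₀ k ω) (fun ω k => (xs k ω, z k ω, y k ω)) Q

end SubstituteAdjustment

end

/-!
Given fixed centers `muCheck` whose relative errors are at most `1/10`, an observation `x` from
component `z` can be assigned to `v ≠ z` only if the component of `x - μ(z)` in the direction of
`muCheck v - muCheck z` is at least `3/8` of the length of that vector, which in turn is at least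
`4/5 ‖μ(z) - μ(v)‖` (`inner_ge_of_norm_sub_le`). As the coordinates are conditionally independent,
Chebyshev's inequality, or the Chernoff bound in the sub-Gaussian case, bounds the conditional
probability of this event by a multiple of `1 / sep(p)`, respectively by `exp (-c sep(p))`. The
centers are independent of the observation, so that they can be frozen, and the probability `α` of a
wrong label is at most the probability of bad centers plus this tail
(`measure_substitute_ne_le_of_isData`).

Consistency only needs `α → 0`. The least squares coefficient is a continuous function of row means
and of the normalized group sums `n⁻¹ ∑_{ℓ_k = v} a_k` for `a = 1, x, y`
(`betaOLS_eq_withinCov_div`). Wrong labels change a group sum by at most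
`n⁻¹ ∑ |a_k| 1(ℓ'_k ≠ ℓ_k)`, whose expectation is `O(√α)` by Cauchy-Schwarz
(`tendstoInMeasure_labelMean_sub`), and the sums with correct labels obey the law of large numbers.

If the growth of `sep(p)` gives `n α → 0`, then with probability tending to one all labels are
correct and the two estimators coincide, so that they have the same limit laws at every scale.
Finally, the error of the oracle estimator is `n⁻¹ ∑ ξ_k η_k`, with the residuals `ξ = X - μ(Z)`
and `η = Y - g(Z) - β ξ`, minus products of group means of `ξ` and `η`, divided by the within-group
sample variance of `x`. The products are of order `1 / n`, so that the central limit theorem and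
Slutsky's theorem give asymptotic normality with the sandwich variance
(`tendstoInDistribution_betaOLS`). The limit theorems for the rows of a triangular array follow from
those for sequences, because they only depend on the law of each row.
-/

namespace SubstituteAdjustment

/-! ### Convergence in probability to constants -/

section InMeasure

variable {Ω : Type*} [MeasurableSpace Ω] {Q : Measure Ω}

theorem tendstoInMeasure_const {c : ℝ} :
    TendstoInMeasure Q (fun (_ : ℕ) (_ : Ω) => c) atTop (fun _ => c) := by
  intro ε hε
  simp [hε.not_ge]

/-- Continuous mapping for two sequences that converge in probability to constants. No
measurability is needed. -/
theorem tendstoInMeasure_comp₂ {f g : ℕ → Ω → ℝ} {a b : ℝ} {F : ℝ → ℝ → ℝ}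
    (hf : TendstoInMeasure Q f atTop (fun _ => a)) (hg : TendstoInMeasure Q g atTop (fun _ => b))
    (hF : ContinuousAt (fun q : ℝ × ℝ => F q.1 q.2) (a, b)) :
    TendstoInMeasure Q (fun r ω => F (f r ω) (g r ω)) atTop (fun _ => F a b) := by
  rw [tendstoInMeasure_iff_dist] at hf hg ⊢
  intro ε hε
  obtain ⟨δ, hδ, hδF⟩ := Metric.continuousAt_iff.1 hF ε hε
  have h0 := (hf δ hδ).add (hg δ hδ)
  rw [add_zero] at h0
  refine tendsto_of_tendsto_of_tendsto_of_le_of_le tendsto_const_nhds h0 (fun _ => zero_le)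
    fun r => (measure_mono fun ω hω => ?_).trans (measure_union_le _ _)
  by_contra hcon
  simp only [Set.mem_union, Set.mem_ofPred_eq, not_or, not_le] at hcon hω
  refine absurd (hδF (x := (f r ω, g r ω)) ?_) (not_lt.2 hω)
  rw [Prod.dist_eq]
  exact max_lt hcon.1 hcon.2

theorem tendstoInMeasure_add {f g : ℕ → Ω → ℝ} {a b : ℝ}
    (hf : TendstoInMeasure Q f atTop (fun _ => a)) (hg : TendstoInMeasure Q g atTop (fun _ => b)) :
    TendstoInMeasure Q (fun r ω => f r ω + g r ω) atTop (fun _ => a + b) :=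
  tendstoInMeasure_comp₂ (F := fun s t => s + t) hf hg (by fun_prop)

theorem tendstoInMeasure_sub {f g : ℕ → Ω → ℝ} {a b : ℝ}
    (hf : TendstoInMeasure Q f atTop (fun _ => a)) (hg : TendstoInMeasure Q g atTop (fun _ => b)) :
    TendstoInMeasure Q (fun r ω => f r ω - g r ω) atTop (fun _ => a - b) :=
  tendstoInMeasure_comp₂ (F := fun s t => s - t) hf hg (by fun_prop)

theorem tendstoInMeasure_mul {f g : ℕ → Ω → ℝ} {a b : ℝ}
    (hf : TendstoInMeasure Q f atTop (fun _ => a)) (hg : TendstoInMeasure Q g atTop (fun _ => b)) :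
    TendstoInMeasure Q (fun r ω => f r ω * g r ω) atTop (fun _ => a * b) :=
  tendstoInMeasure_comp₂ (F := fun s t => s * t) hf hg (by fun_prop)

theorem tendstoInMeasure_div {f g : ℕ → Ω → ℝ} {a b : ℝ} (hb : b ≠ 0)
    (hf : TendstoInMeasure Q f atTop (fun _ => a)) (hg : TendstoInMeasure Q g atTop (fun _ => b)) :
    TendstoInMeasure Q (fun r ω => f r ω / g r ω) atTop (fun _ => a / b) :=
  tendstoInMeasure_comp₂ (F := fun s t => s / t) hf hg
    (ContinuousAt.div continuousAt_fst continuousAt_snd hb)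

theorem tendstoInMeasure_sum {ι : Type*} (s : Finset ι) {f : ι → ℕ → Ω → ℝ} {a : ι → ℝ}
    (h : ∀ j ∈ s, TendstoInMeasure Q (f j) atTop (fun _ => a j)) :
    TendstoInMeasure Q (fun r ω => ∑ j ∈ s, f j r ω) atTop (fun _ => ∑ j ∈ s, a j) := by
  classical
  induction s using Finset.induction_on with
  | empty => simpa using tendstoInMeasure_const
  | insert j s hj ih =>
    simp only [Finset.sum_insert hj]
    exact tendstoInMeasure_add (h j (by simp)) (ih fun k hk => h k (by simp [hk]))

theorem tendstoInMeasure_abs_sub {f g : ℕ → Ω → ℝ} {a : ℝ}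
    (hf : TendstoInMeasure Q f atTop (fun _ => a)) (hg : TendstoInMeasure Q g atTop (fun _ => a)) :
    TendstoInMeasure Q (fun r ω => |f r ω - g r ω|) atTop (fun _ => 0) := by
  have := tendstoInMeasure_comp₂ (F := fun s t => |s - t|) hf hg (by fun_prop)
  simpa using this

/-- Random variables that vanish with probability tending to one converge to zero in
probability. -/
theorem tendstoInMeasure_zero_of_measure_ne {f : ℕ → Ω → ℝ}
    (h : Tendsto (fun r => Q {ω | f r ω ≠ 0}) atTop (𝓝 0)) :
    TendstoInMeasure Q f atTop (fun _ => 0) := by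
  intro ε hε
  refine tendsto_of_tendsto_of_tendsto_of_le_of_le tendsto_const_nhds h (fun _ => zero_le)
    fun r => measure_mono fun ω hω h0 => ?_
  simp only [Set.mem_ofPred_eq] at hω
  rw [h0, edist_self] at hω
  exact absurd hω hε.not_ge

/-- Convergence to zero in `L¹` implies convergence to zero in probability. -/
theorem tendstoInMeasure_zero_of_lintegral {f : ℕ → Ω → ℝ} (hf : ∀ r, AEMeasurable (f r) Q)
    (h : Tendsto (fun r => ∫⁻ ω, ‖f r ω‖ₑ ∂Q) atTop (𝓝 0)) :
    TendstoInMeasure Q f atTop (fun _ => 0) := by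
  refine tendstoInMeasure_of_tendsto_eLpNorm one_ne_zero
    (fun r => (hf r).aestronglyMeasurable) aestronglyMeasurable_const ?_
  simpa [eLpNorm_one_eq_lintegral_enorm] using h

theorem lintegral_enorm_mul_le {f g : Ω → ℝ} (hf : AEMeasurable f Q) (hg : AEMeasurable g Q) :
    ∫⁻ ω, ‖f ω * g ω‖ₑ ∂Q ≤
      (∫⁻ ω, ‖f ω‖ₑ ^ 2 ∂Q) ^ (1 / 2 : ℝ) * (∫⁻ ω, ‖g ω‖ₑ ^ 2 ∂Q) ^ (1 / 2 : ℝ) := by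
  have := ENNReal.lintegral_mul_le_Lp_mul_Lq Q Real.HolderConjugate.two_two hf.enorm hg.enorm
  simpa [enorm_mul] using this

/-- Independence allows to bound the probability of an event that depends on the pair `(U, V)`
by freezing `U`. -/
theorem measure_le_of_indepFun [IsProbabilityMeasure Q] {α β : Type*} [MeasurableSpace α]
    [MeasurableSpace β] {U : Ω → α} {V : Ω → β} (hU : AEMeasurable U Q) (hV : AEMeasurable V Q)
    (hUV : IndepFun U V Q) {A : Set (α × β)} (hA : MeasurableSet A) {C : ℝ≥0∞}
    (hC : ∀ u, (Q.map V) {v | (u, v) ∈ A} ≤ C) : Q {ω | (U ω, V ω) ∈ A} ≤ C := by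
  have : IsProbabilityMeasure (Q.map U) := Measure.isProbabilityMeasure_map hU
  have : IsProbabilityMeasure (Q.map V) := Measure.isProbabilityMeasure_map hV
  have h1 : Q {ω | (U ω, V ω) ∈ A} = (Q.map fun ω => (U ω, V ω)) A :=
    (Measure.map_apply_of_aemeasurable (hU.prodMk hV) hA).symm
  rw [h1, hUV.map_prod_eq_prod_map_map hU hV, Measure.prod_apply hA]
  calc ∫⁻ u, (Q.map V) (Prod.mk u ⁻¹' A) ∂(Q.map U) ≤ ∫⁻ _, C ∂(Q.map U) :=
        lintegral_mono fun u => hC u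
    _ = C := by simp

end InMeasure

/-! ### Limit theorems for row-wise i.i.d. arrays -/

section Arrays

variable {Ω Ω₀ : Type*} [MeasurableSpace Ω] [MeasurableSpace Ω₀] {Q : Measure Ω} {P : Measure Ω₀}

/-- A real random variable has an i.i.d. sequence of copies on some probability space. -/
theorem exists_iid_copies [IsProbabilityMeasure P] {V : Ω₀ → ℝ} (hV : AEMeasurable V P) :
    ∃ (Ω' : Type) (_ : MeasurableSpace Ω') (P' : Measure Ω') (W : ℕ → Ω' → ℝ),
      IsProbabilityMeasure P' ∧ (∀ k, IdentDistrib (W k) V P' P) ∧ iIndepFun W P' := by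
  have : IsProbabilityMeasure (P.map V) := Measure.isProbabilityMeasure_map hV
  obtain ⟨Ω', m', P', W, -, hlaw, hind, hP'⟩ := exists_iid ℕ (P.map V)
  exact ⟨Ω', m', P', W, hP', fun k => ⟨(hlaw k).aemeasurable, hV, (hlaw k).map_eq⟩, hind⟩

variable {n : ℕ → ℕ} {V : Ω₀ → ℝ} {A : ∀ r, Fin (n r) → Ω → ℝ}

/-- The law of a row sum is that of the corresponding partial sum of an i.i.d. sequence. -/
theorem identDistrib_row_sum (hA : ∀ r k, IdentDistrib (A r k) V Q P)
    (hind : ∀ r, iIndepFun (A r) Q) {Ω' : Type*} [MeasurableSpace Ω'] {P' : Measure Ω'}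
    {W : ℕ → Ω' → ℝ} (hW : ∀ k, IdentDistrib (W k) V P' P) (hWind : iIndepFun W P') (r : ℕ) :
    IdentDistrib (fun ω => ∑ k, A r k ω) (fun ω => ∑ k ∈ Finset.range (n r), W k ω) Q P' := by
  have h := IdentDistrib.pi (fun k : Fin (n r) => (hA r k).trans (hW k).symm) (hind r)
    (hWind.precomp Fin.val_injective)
  have h2 := h.comp (u := fun a : Fin (n r) → ℝ => ∑ k, a k) (by fun_prop)
  refine ⟨h2.aemeasurable_fst, ?_, ?_⟩
  · simpa [Function.comp_def, Finset.sum_range] using h2.aemeasurable_snd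
  · simpa [Function.comp_def, Finset.sum_range] using h2.map_eq

/-- The weak law of large numbers for row-wise i.i.d. arrays. -/
theorem tendstoInMeasure_row_mean [IsProbabilityMeasure P] (hn : Tendsto n atTop atTop)
    (hV : Integrable V P)
    (hA : ∀ r k, IdentDistrib (A r k) V Q P) (hind : ∀ r, iIndepFun (A r) Q) :
    TendstoInMeasure Q (fun r ω => (∑ k, A r k ω) / n r) atTop (fun _ => ∫ ω, V ω ∂P) := by
  obtain ⟨Ω', m', P', W, hP', hW, hWind⟩ := exists_iid_copies hV.aemeasurable
  have hWm : ∀ k, AEMeasurable (W k) P' := fun k => (hW k).aemeasurable_fst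
  have h1 := strong_law_ae_real W ((hW 0).integrable_iff.2 hV)
    (fun a b hab => hWind.indepFun hab) (fun k => (hW k).trans (hW 0).symm)
  rw [(hW 0).integral_eq] at h1
  have h2 := (tendstoInMeasure_of_tendsto_ae (f := fun (l : ℕ) ω =>
    (∑ k ∈ Finset.range l, W k ω) / l) (fun l => AEMeasurable.aestronglyMeasurable
      ((Finset.aemeasurable_fun_sum _ fun k _ => hWm k).div_const _)) h1).comp hn
  rw [tendstoInMeasure_iff_dist] at h2 ⊢
  intro ε hε
  refine (h2 ε hε).congr fun r => ?_
  have h3 := (identDistrib_row_sum hA hind hW hWind r).div_const (n r : ℝ)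
  have h4 := h3.measure_mem_eq (s := {t | ε ≤ dist t (∫ ω, V ω ∂P)})
    (measurableSet_le measurable_const (by fun_prop))
  exact h4.symm

/-- The central limit theorem for row-wise i.i.d. arrays of centered variables. -/
theorem tendstoInDistribution_row_sum [IsProbabilityMeasure Q] [IsProbabilityMeasure P]
    (hn : Tendsto n atTop atTop) (hV : MemLp V 2 P)
    (hV0 : ∫ ω, V ω ∂P = 0) (hA : ∀ r k, IdentDistrib (A r k) V Q P)
    (hind : ∀ r, iIndepFun (A r) Q) :
    TendstoInDistribution (fun r ω => (√(n r))⁻¹ * ∑ k, A r k ω) atTop id (fun _ => Q)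
      (gaussianReal 0 (∫ ω, V ω ^ 2 ∂P).toNNReal) := by
  obtain ⟨Ω', m', P', W, hP', hW, hWind⟩ := exists_iid_copies hV.1.aemeasurable
  have hvar : Var[W 0; P'] = ∫ ω, V ω ^ 2 ∂P := by
    rw [(hW 0).variance_eq, variance_eq_integral hV.1.aemeasurable, hV0]
    simp
  have h1 := tendstoInDistribution_inv_sqrt_mul_sum_sub (P := P') (X := W)
    (P' := gaussianReal 0 Var[W 0; P'].toNNReal) HasLaw.id ((hW 0).memLp_iff.2 hV) hWind
    (fun k => (hW k).trans (hW 0).symm)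
  have h0 : P'[W 0] = 0 := by rw [(hW 0).integral_eq, hV0]
  simp only [h0, mul_zero, sub_zero] at h1
  rw [hvar] at h1
  have hid r : IdentDistrib (fun ω => (√(n r))⁻¹ * ∑ k, A r k ω)
      (fun ω => (√(n r))⁻¹ * ∑ k ∈ Finset.range (n r), W k ω) Q P' :=
    (identDistrib_row_sum hA hind hW hWind r).const_mul _
  refine ⟨fun r => (hid r).aemeasurable_fst, aemeasurable_id, ?_⟩
  refine (h1.tendsto.comp hn).congr fun r => ?_
  exact Subtype.ext (hid r).map_eq.symm

theorem lintegral_row_sum_sq [IsProbabilityMeasure Q] [IsFiniteMeasure P] (hV : MemLp V 2 P)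
    (hV0 : ∫ ω, V ω ∂P = 0) (hA : ∀ r k, IdentDistrib (A r k) V Q P)
    (hind : ∀ r, iIndepFun (A r) Q) (r : ℕ) :
    ∫⁻ ω, ‖∑ k, A r k ω‖ₑ ^ 2 ∂Q = ENNReal.ofReal (n r * ∫ ω, V ω ^ 2 ∂P) := by
  have hAm : ∀ k, MemLp (A r k) 2 Q := fun k => (hA r k).memLp_iff.2 hV
  have hS : MemLp (∑ k, A r k) 2 Q := memLp_finsetSum' _ fun k _ => hAm k
  have hmean : ∫ ω, (∑ k, A r k) ω ∂Q = 0 := by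
    simp only [Finset.sum_apply]
    rw [integral_finsetSum _ fun k _ => (hAm k).integrable (by norm_num)]
    simp [(hA r _).integral_eq, hV0]
  have hvar : Var[∑ k, A r k; Q] = n r * ∫ ω, V ω ^ 2 ∂P := by
    rw [IndepFun.variance_sum (fun k _ => hAm k) fun k _ l _ hkl => (hind r).indepFun hkl]
    simp only [(hA r _).variance_eq, variance_eq_integral hV.1.aemeasurable, hV0, sub_zero]
    simp
  rw [← hvar, hS.ofReal_variance_eq, evariance, hmean]
  simp

/-- The product of two row means of centered variables is of smaller order than `1 / √n`: by
Cauchy-Schwarz its `L¹` norm is of order `1 / n`. -/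
theorem tendstoInMeasure_row_mean_mul [IsProbabilityMeasure Q] [IsFiniteMeasure P] {V' : Ω₀ → ℝ}
    {A' : ∀ r, Fin (n r) → Ω → ℝ} (hn : Tendsto n atTop atTop) (hV : MemLp V 2 P)
    (hV0 : ∫ ω, V ω ∂P = 0) (hA : ∀ r k, IdentDistrib (A r k) V Q P)
    (hind : ∀ r, iIndepFun (A r) Q) (hV' : MemLp V' 2 P)
    (hV0' : ∫ ω, V' ω ∂P = 0) (hA' : ∀ r k, IdentDistrib (A' r k) V' Q P)
    (hind' : ∀ r, iIndepFun (A' r) Q) :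
    TendstoInMeasure Q (fun r ω => √(n r) * ((∑ k, A r k ω) / n r * ((∑ k, A' r k ω) / n r)))
      atTop (fun _ => 0) := by
  have hm : ∀ r, AEMeasurable (fun ω => ∑ k, A r k ω) Q := fun r =>
    Finset.aemeasurable_fun_sum _ fun k _ => (hA r k).aemeasurable_fst
  have hm' : ∀ r, AEMeasurable (fun ω => ∑ k, A' r k ω) Q := fun r =>
    Finset.aemeasurable_fun_sum _ fun k _ => (hA' r k).aemeasurable_fst
  refine tendstoInMeasure_zero_of_lintegral
    (fun r => (((hm r).div_const _).mul ((hm' r).div_const _)).const_mul _) ?_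
  set s := ∫ ω, V ω ^ 2 ∂P with hs
  set s' := ∫ ω, V' ω ^ 2 ∂P with hs'
  have hs0 : 0 ≤ s := integral_nonneg fun ω => sq_nonneg _
  have hs0' : 0 ≤ s' := integral_nonneg fun ω => sq_nonneg _
  have hlim : Tendsto (fun r => ENNReal.ofReal (√s * √s' * (√(n r))⁻¹)) atTop (𝓝 0) := by
    have h1 : Tendsto (fun r => (√(n r : ℝ))⁻¹) atTop (𝓝 0) :=
      tendsto_inv_atTop_zero.comp
        (Real.tendsto_sqrt_atTop.comp (tendsto_natCast_atTop_atTop.comp hn))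
    have h2 := ENNReal.tendsto_ofReal (h1.const_mul (√s * √s'))
    simpa using h2
  refine tendsto_of_tendsto_of_tendsto_of_le_of_le tendsto_const_nhds hlim (fun _ => zero_le)
    fun r => ?_
  have hre : ∀ ω, √(n r) * ((∑ k, A r k ω) / n r * ((∑ k, A' r k ω) / n r)) =
      (√(n r) / (n r * n r)) * ((∑ k, A r k ω) * ∑ k, A' r k ω) := fun ω => by ring
  simp only [hre]
  calc ∫⁻ ω, ‖(√(n r) / (n r * n r)) * ((∑ k, A r k ω) * ∑ k, A' r k ω)‖ₑ ∂Q
      = ‖√(n r) / (n r * n r)‖ₑ * ∫⁻ ω, ‖(∑ k, A r k ω) * ∑ k, A' r k ω‖ₑ ∂Q := by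
        simp only [enorm_mul (√(n r : ℝ) / _)]
        exact lintegral_const_mul' _ _ enorm_ne_top
    _ ≤ ‖√(n r) / (n r * n r)‖ₑ * (ENNReal.ofReal (n r * s) ^ (1 / 2 : ℝ) *
          ENNReal.ofReal (n r * s') ^ (1 / 2 : ℝ)) := by
        gcongr
        refine (lintegral_enorm_mul_le (hm r) (hm' r)).trans_eq ?_
        rw [lintegral_row_sum_sq hV hV0 hA hind, lintegral_row_sum_sq hV' hV0' hA' hind']
    _ = ENNReal.ofReal (√s * √s' * (√(n r))⁻¹) := by
        rw [ENNReal.ofReal_rpow_of_nonneg (by positivity) (by norm_num),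
          ENNReal.ofReal_rpow_of_nonneg (by positivity) (by norm_num), ← Real.sqrt_eq_rpow,
          ← Real.sqrt_eq_rpow, Real.enorm_eq_ofReal (by positivity),
          ← ENNReal.ofReal_mul (by positivity), ← ENNReal.ofReal_mul (by positivity)]
        congr 1
        rw [Real.sqrt_mul (by positivity), Real.sqrt_mul (by positivity)]
        by_cases h0 : n r = 0
        · simp [h0]
        · have h1 : (0 : ℝ) < n r := Nat.cast_pos.2 (Nat.pos_of_ne_zero h0)
          have h2 : √(n r : ℝ) ^ 2 = n r := Real.sq_sqrt h1.le
          have h3 : 0 < √(n r : ℝ) := Real.sqrt_pos.2 h1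
          generalize √(n r : ℝ) = q at *
          rw [← h2]
          field_simp

end Arrays

/-! ### Least squares with group labels -/

section Algebra

variable {K n : ℕ}

/-- The normalized group sum `n⁻¹ ∑_{k : ℓ_k = v} a_k`. -/
noncomputable def labelMean (label : Fin n → Fin K) (a : Fin n → ℝ) (v : Fin K) : ℝ :=
  (∑ k with label k = v, a k) / n

/-- The sample covariance within groups, written with sums over groups:
`n⁻¹ ∑ a_k b_k - ∑_v (n⁻¹ ∑_{ℓ_k = v} a_k) (n⁻¹ ∑_{ℓ_k = v} b_k) / (n_v / n)`. -/
noncomputable def withinCov (label : Fin n → Fin K) (a b : Fin n → ℝ) : ℝ :=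
  (∑ k, a k * b k) / n -
    ∑ v, labelMean label a v * labelMean label b v / labelMean label (fun _ => 1) v

theorem sum_sub_groupMean_mul (label : Fin n → Fin K) (a b : Fin n → ℝ) :
    ∑ k, (a k - groupMean label a (label k)) * (b k - groupMean label b (label k)) =
      ∑ k, a k * b k - ∑ v, (∑ k with label k = v, a k) * (∑ k with label k = v, b k) /
        (Finset.card {k | label k = v} : ℝ) := by
  rw [← Finset.sum_fiberwise Finset.univ label
      (fun k => (a k - groupMean label a (label k)) * (b k - groupMean label b (label k))),
    ← Finset.sum_fiberwise Finset.univ label (fun k => a k * b k),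
    ← Finset.sum_sub_distrib]
  refine Finset.sum_congr rfl fun v _ => ?_
  have h1 : ∑ k with label k = v,
      (a k - groupMean label a (label k)) * (b k - groupMean label b (label k)) =
      ∑ k with label k = v, (a k * b k - groupMean label b v * a k - groupMean label a v * b k
        + groupMean label a v * groupMean label b v) := by
    refine Finset.sum_congr rfl fun k hk => ?_
    rw [(Finset.mem_filter.1 hk).2]
    ring
  rw [h1, Finset.sum_add_distrib, Finset.sum_sub_distrib, Finset.sum_sub_distrib,
    ← Finset.mul_sum, ← Finset.mul_sum, Finset.sum_const, nsmul_eq_mul]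
  unfold groupMean
  by_cases hc : (Finset.card {k | label k = v} : ℝ) = 0
  · simp [hc]
  · field_simp
    ring

theorem sum_sub_groupMean_mul_div (label : Fin n → Fin K) (a b : Fin n → ℝ) :
    (∑ k, (a k - groupMean label a (label k)) * (b k - groupMean label b (label k))) / n =
      withinCov label a b := by
  rw [sum_sub_groupMean_mul, withinCov, sub_div]
  refine congrArg₂ _ rfl ((Finset.sum_div _ _ _).trans <| Finset.sum_congr rfl fun v _ => ?_)
  unfold labelMean
  rw [Finset.sum_const (b := (1 : ℝ)), nsmul_eq_mul, mul_one]
  by_cases hn : (n : ℝ) = 0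
  · simp [hn]
  by_cases hc : (Finset.card {k | label k = v} : ℝ) = 0
  · simp [hc]
  · field_simp

theorem betaOLS_eq_withinCov_div (label : Fin n → Fin K) (x y : Fin n → ℝ) :
    betaOLS label x y = withinCov label x y / withinCov label x x := by
  rw [← sum_sub_groupMean_mul_div, ← sum_sub_groupMean_mul_div, betaOLS]
  simp_rw [← sq]
  by_cases hn : n = 0
  · subst hn
    simp
  · rw [div_div_div_cancel_right₀ (Nat.cast_ne_zero.2 hn)]

/-- Within groups, the covariance of `x` with `y - β x` is not changed when constants are
subtracted from `x` and `y` in every group. -/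
theorem withinCov_sub_eq (label : Fin n → Fin K) (x y : Fin n → ℝ) (c d : Fin K → ℝ) (β : ℝ) :
    withinCov label x y - β * withinCov label x x =
      withinCov label (fun k => x k - c (label k))
        (fun k => y k - d (label k) - β * (x k - c (label k))) := by
  have hshift : ∀ (a : Fin n → ℝ) (e : Fin K → ℝ) (k : Fin n),
      groupMean label (fun l => a l - e (label l)) (label k) =
        groupMean label a (label k) - e (label k) := by
    intro a e k
    have hc : (Finset.card {l | label l = label k} : ℝ) ≠ 0 :=
      Nat.cast_ne_zero.2 (Finset.card_ne_zero.2 ⟨k, by simp⟩)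
    have h1 : ∑ l with label l = label k, (a l - e (label l)) =
        ∑ l with label l = label k, (a l - e (label k)) :=
      Finset.sum_congr rfl fun l hl => by rw [(Finset.mem_filter.1 hl).2]
    unfold groupMean
    rw [h1, Finset.sum_sub_distrib, Finset.sum_const, nsmul_eq_mul]
    field_simp
  have hlin : ∀ (a b : Fin n → ℝ) (v : Fin K), groupMean label (fun l => a l - β * b l) v =
      groupMean label a v - β * groupMean label b v := by
    intro a b v
    unfold groupMean
    rw [Finset.sum_sub_distrib, ← Finset.mul_sum]
    ring
  rw [← sum_sub_groupMean_mul_div, ← sum_sub_groupMean_mul_div, ← sum_sub_groupMean_mul_div,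
    ← mul_div_assoc, ← sub_div, Finset.mul_sum, ← Finset.sum_sub_distrib]
  congr 1
  refine Finset.sum_congr rfl fun k _ => ?_
  rw [hlin (fun l => y l - d (label l)) (fun l => x l - c (label l)), hshift, hshift]
  ring

theorem enorm_labelMean_sub_le (l l' : Fin n → Fin K) (a : Fin n → ℝ) (v : Fin K) :
    ‖labelMean l' a v - labelMean l a v‖ₑ ≤
      ‖(n : ℝ)⁻¹‖ₑ * ∑ k, ‖a k * (if l' k ≠ l k then 1 else 0)‖ₑ := by
  unfold labelMean
  rw [← sub_div, div_eq_inv_mul, enorm_mul, Finset.sum_filter,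
    Finset.sum_filter, ← Finset.sum_sub_distrib]
  gcongr
  refine (enorm_sum_le _ _).trans (Finset.sum_le_sum fun k _ => ?_)
  by_cases h : l' k = l k
  · simp [h]
  · by_cases h1 : l' k = v
    · have h2 : l k ≠ v := fun h2 => h (h1.trans h2.symm)
      simp [h1, h2, h2.symm]
    · by_cases h2 : l k = v <;> simp [h1, h2]

end Algebra

section Consistency

variable {Ω : Type*} [MeasurableSpace Ω] {Q : Measure Ω} {K : ℕ} {n : ℕ → ℕ}

theorem aemeasurable_labelMean {n : ℕ} {l : Fin n → Ω → Fin K} {a : Fin n → Ω → ℝ}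
    (hl : ∀ k, AEMeasurable (l k) Q) (ha : ∀ k, AEMeasurable (a k) Q) (v : Fin K) :
    AEMeasurable (fun ω => labelMean (fun k => l k ω) (fun k => a k ω) v) Q := by
  unfold labelMean
  simp only [Finset.sum_filter]
  refine (Finset.aemeasurable_fun_sum _ fun k _ => ?_).div_const _
  have hs : NullMeasurableSet {ω | l k ω = v} Q :=
    nullMeasurableSet_eq_fun (hl k) aemeasurable_const
  exact ((ha k).indicator₀ hs).congr (ae_of_all _ fun ω => by simp [Set.indicator_apply])

theorem aemeasurable_withinCov {n : ℕ} {l : Fin n → Ω → Fin K} {a b : Fin n → Ω → ℝ}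
    (hl : ∀ k, AEMeasurable (l k) Q) (ha : ∀ k, AEMeasurable (a k) Q)
    (hb : ∀ k, AEMeasurable (b k) Q) :
    AEMeasurable (fun ω => withinCov (fun k => l k ω) (fun k => a k ω) (fun k => b k ω)) Q := by
  unfold withinCov
  refine ((Finset.aemeasurable_fun_sum _ fun k _ => (ha k).mul (hb k)).div_const _).sub
    (Finset.aemeasurable_fun_sum _ fun v _ => ?_)
  exact ((aemeasurable_labelMean hl ha v).mul (aemeasurable_labelMean hl hb v)).div
    (aemeasurable_labelMean (a := fun _ _ => 1) hl (fun _ => aemeasurable_const) v)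

theorem aemeasurable_betaOLS {n : ℕ} {l : Fin n → Ω → Fin K} {a b : Fin n → Ω → ℝ}
    (hl : ∀ k, AEMeasurable (l k) Q) (ha : ∀ k, AEMeasurable (a k) Q)
    (hb : ∀ k, AEMeasurable (b k) Q) :
    AEMeasurable (fun ω => betaOLS (fun k => l k ω) (fun k => a k ω) (fun k => b k ω)) Q := by
  simp only [betaOLS_eq_withinCov_div]
  exact (aemeasurable_withinCov hl ha hb).div (aemeasurable_withinCov hl ha ha)

theorem tendstoInMeasure_withinCov {label : ∀ r, Fin (n r) → Ω → Fin K}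
    {a b : ∀ r, Fin (n r) → Ω → ℝ} {α β ρ : Fin K → ℝ} {γ : ℝ} (hρ : ∀ v, ρ v ≠ 0)
    (hab : TendstoInMeasure Q (fun r ω => (∑ k, a r k ω * b r k ω) / n r) atTop (fun _ => γ))
    (ha : ∀ v, TendstoInMeasure Q (fun r ω =>
      labelMean (fun k => label r k ω) (fun k => a r k ω) v) atTop (fun _ => α v))
    (hb : ∀ v, TendstoInMeasure Q (fun r ω =>
      labelMean (fun k => label r k ω) (fun k => b r k ω) v) atTop (fun _ => β v))
    (h1 : ∀ v, TendstoInMeasure Q (fun r ω =>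
      labelMean (fun k => label r k ω) (fun _ => 1) v) atTop (fun _ => ρ v)) :
    TendstoInMeasure Q (fun r ω =>
      withinCov (fun k => label r k ω) (fun k => a r k ω) (fun k => b r k ω)) atTop
      (fun _ => γ - ∑ v, α v * β v / ρ v) :=
  tendstoInMeasure_sub hab (tendstoInMeasure_sum _ fun v _ =>
    tendstoInMeasure_div (hρ v) (tendstoInMeasure_mul (ha v) (hb v)) (h1 v))

/-- If the probability that two labels differ tends to zero uniformly in `k`, then the normalized
group sums of variables with bounded second moments are asymptotically the same; this is
Cauchy-Schwarz applied to `E |a_k| 1(ℓ'_k ≠ ℓ_k)`. -/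
theorem tendstoInMeasure_labelMean_sub {l l' : ∀ r, Fin (n r) → Ω → Fin K}
    {a : ∀ r, Fin (n r) → Ω → ℝ} (hl : ∀ r k, AEMeasurable (l r k) Q)
    (hl' : ∀ r k, AEMeasurable (l' r k) Q) (ha : ∀ r k, AEMeasurable (a r k) Q)
    {M : ℝ≥0∞} (hM : M ≠ ⊤) (haM : ∀ r k, ∫⁻ ω, ‖a r k ω‖ₑ ^ 2 ∂Q ≤ M) {α : ℕ → ℝ≥0∞}
    (hα : ∀ r k, Q {ω | l' r k ω ≠ l r k ω} ≤ α r) (hα0 : Tendsto α atTop (𝓝 0)) (v : Fin K) :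
    TendstoInMeasure Q (fun r ω =>
      labelMean (fun k => l' r k ω) (fun k => a r k ω) v -
        labelMean (fun k => l r k ω) (fun k => a r k ω) v) atTop (fun _ => 0) := by
  classical
  have hms : ∀ r k, NullMeasurableSet {ω | l' r k ω ≠ l r k ω} Q := fun r k =>
    (nullMeasurableSet_eq_fun (hl' r k) (hl r k)).compl
  have hone : ∀ r k, AEMeasurable (fun ω => if l' r k ω ≠ l r k ω then (1 : ℝ) else 0) Q :=
    fun r k => ((aemeasurable_const (b := (1 : ℝ))).indicator₀ (hms r k)).congr
      (ae_of_all _ fun ω => by simp [Set.indicator_apply])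
  refine tendstoInMeasure_zero_of_lintegral (fun r =>
    (aemeasurable_labelMean (hl' r) (ha r) v).sub (aemeasurable_labelMean (hl r) (ha r) v)) ?_
  have hlim : Tendsto (fun r => M ^ (1 / 2 : ℝ) * α r ^ (1 / 2 : ℝ)) atTop (𝓝 0) := by
    have h1 : Tendsto (fun r => α r ^ (1 / 2 : ℝ)) atTop (𝓝 0) := by
      simpa [Function.comp_def] using
        (ENNReal.continuous_rpow_const (y := (1 / 2 : ℝ))).continuousAt.tendsto.comp hα0
    simpa using ENNReal.Tendsto.const_mul h1
      (Or.inr (ENNReal.rpow_ne_top_of_nonneg (by norm_num) hM))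
  refine tendsto_of_tendsto_of_tendsto_of_le_of_le tendsto_const_nhds hlim (fun _ => zero_le)
    fun r => ?_
  have hk : ∀ k, ∫⁻ ω, ‖a r k ω * (if l' r k ω ≠ l r k ω then 1 else 0)‖ₑ ∂Q ≤
      M ^ (1 / 2 : ℝ) * α r ^ (1 / 2 : ℝ) := by
    intro k
    refine (lintegral_enorm_mul_le (ha r k) (hone r k)).trans ?_
    gcongr
    · exact haM r k
    · refine le_trans (le_of_eq ?_) (hα r k)
      rw [← lintegral_indicator_one₀ (hms r k)]
      refine lintegral_congr fun ω => ?_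
      by_cases h : l' r k ω = l r k ω <;> simp [h]
  calc ∫⁻ ω, ‖labelMean (fun k => l' r k ω) (fun k => a r k ω) v -
        labelMean (fun k => l r k ω) (fun k => a r k ω) v‖ₑ ∂Q
      ≤ ∫⁻ ω, ‖(n r : ℝ)⁻¹‖ₑ * ∑ k, ‖a r k ω * (if l' r k ω ≠ l r k ω then 1 else 0)‖ₑ ∂Q := by
        exact lintegral_mono fun ω =>
          enorm_labelMean_sub_le (fun k => l r k ω) (fun k => l' r k ω) (fun k => a r k ω) v
    _ ≤ ‖(n r : ℝ)⁻¹‖ₑ * ∑ k : Fin (n r), M ^ (1 / 2 : ℝ) * α r ^ (1 / 2 : ℝ) := by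
        rw [lintegral_const_mul' _ _ enorm_ne_top, lintegral_finsetSum']
        swap
        · exact fun k _ => ((ha r k).mul (hone r k)).enorm
        gcongr with k
        exact hk k
    _ ≤ M ^ (1 / 2 : ℝ) * α r ^ (1 / 2 : ℝ) := by
        rw [Finset.sum_const, nsmul_eq_mul, Finset.card_univ, Fintype.card_fin, ← mul_assoc]
        refine mul_le_of_le_one_left zero_le ?_
        by_cases h0 : n r = 0
        · simp [h0]
        · have : (n r : ℝ≥0∞) = ‖(n r : ℝ)‖ₑ := by simp
          rw [this, ← enorm_mul, inv_mul_cancel₀ (Nat.cast_ne_zero.2 h0)]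
          simp

end Consistency

/-! ### The probability of recovering the wrong latent value -/

section Geometry

/-- If the centers `a', b'` approximate `a, b` up to a tenth of `‖a - b‖`, and `x` is at least as
close to `b'` as to `a'`, then the deviation `x - a` has a large component in the direction of
`b' - a'`, and `b' - a'` is not much shorter than `b - a`. -/
theorem inner_ge_of_norm_sub_le {H : Type*} [NormedAddCommGroup H] [InnerProductSpace ℝ H]
    {x a b a' b' : H} (ha : ‖a - a'‖ ≤ ‖a - b‖ / 10) (hb : ‖b - b'‖ ≤ ‖a - b‖ / 10)
    (hx : ‖x - b'‖ ≤ ‖x - a'‖) :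
    3 / 8 * ‖b' - a'‖ ^ 2 ≤ inner ℝ (x - a) (b' - a') ∧ 4 / 5 * ‖a - b‖ ≤ ‖b' - a'‖ := by
  have h1 : ‖a - b‖ ≤ ‖a - a'‖ + ‖b' - a'‖ + ‖b - b'‖ := by
    have e : a - b = (a - a') - (b' - a') - (b - b') := by abel
    calc ‖a - b‖ = ‖(a - a') - (b' - a') - (b - b')‖ := by rw [← e]
      _ ≤ ‖(a - a') - (b' - a')‖ + ‖b - b'‖ := norm_sub_le _ _
      _ ≤ _ := by gcongr; exact norm_sub_le _ _
  have h2 : 4 / 5 * ‖a - b‖ ≤ ‖b' - a'‖ := by linarith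
  refine ⟨?_, h2⟩
  have h3 : ‖x - b'‖ ^ 2 = ‖x - a'‖ ^ 2 - 2 * inner ℝ (x - a') (b' - a') + ‖b' - a'‖ ^ 2 := by
    have e : x - b' = (x - a') - (b' - a') := by abel
    rw [e, norm_sub_sq_real]
  have h4 : ‖x - b'‖ ^ 2 ≤ ‖x - a'‖ ^ 2 := by gcongr
  have h5 : inner ℝ (x - a') (b' - a') =
      inner ℝ (x - a) (b' - a') + inner ℝ (a - a') (b' - a') := by
    rw [← inner_add_left]
    congr 1
    abel
  have h6 : inner ℝ (a - a') (b' - a') ≤ ‖a - a'‖ * ‖b' - a'‖ := real_inner_le_norm _ _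
  have h7 : ‖a - a'‖ * ‖b' - a'‖ ≤ (‖b' - a'‖ / 8) * ‖b' - a'‖ := by
    gcongr
    linarith
  nlinarith

theorem dist2_eq_norm {p : ℕ} (a b : Fin p → ℝ) :
    dist2 a b = ‖WithLp.toLp 2 a - WithLp.toLp 2 b‖ := rfl

theorem dist2_nonneg {p : ℕ} (a b : Fin p → ℝ) : 0 ≤ dist2 a b := norm_nonneg _

theorem dist2_eq_sqrt {p : ℕ} (a b : Fin p → ℝ) : dist2 a b = √(∑ j, (a j - b j) ^ 2) := by
  simp [dist2, EuclideanSpace.norm_eq]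

theorem dist2_sq {p : ℕ} (a b : Fin p → ℝ) : dist2 a b ^ 2 = ∑ j, (a j - b j) ^ 2 := by
  rw [dist2_eq_sqrt, Real.sq_sqrt (Finset.sum_nonneg fun _ _ => sq_nonneg _)]

theorem dist2_comm {p : ℕ} (a b : Fin p → ℝ) : dist2 a b = dist2 b a := by
  rw [dist2_eq_norm, dist2_eq_norm, norm_sub_rev]

theorem sum_mul_ge_of_dist2_le {p : ℕ} {x a b a' b' : Fin p → ℝ} (hab : 0 < dist2 a b)
    (ha : dist2 a a' / dist2 a b ≤ 1 / 10) (hb : dist2 b b' / dist2 b a ≤ 1 / 10)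
    (hx : dist2 x b' ≤ dist2 x a') :
    3 / 8 * ∑ j, (b' j - a' j) ^ 2 ≤ ∑ j, (x j - a j) * (b' j - a' j) ∧
      16 / 25 * dist2 a b ^ 2 ≤ ∑ j, (b' j - a' j) ^ 2 := by
  rw [dist2_comm b a] at hb
  rw [div_le_iff₀ hab] at ha hb
  rw [dist2_eq_norm] at ha hb hx
  rw [dist2_eq_norm] at hx
  obtain ⟨h1, h2⟩ := inner_ge_of_norm_sub_le (x := WithLp.toLp 2 x) (a := WithLp.toLp 2 a)
    (b := WithLp.toLp 2 b) (a' := WithLp.toLp 2 a') (b' := WithLp.toLp 2 b')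
    (by rw [← dist2_eq_norm a b]; linarith) (by rw [← dist2_eq_norm a b]; linarith) hx
  rw [← dist2_eq_norm b' a'] at h1 h2
  rw [dist2_sq] at h1
  refine ⟨h1.trans_eq ?_, ?_⟩
  · simp [PiLp.inner_apply, mul_comm]
  · rw [← dist2_eq_norm a b] at h2
    have h3 : (4 / 5 * dist2 a b) ^ 2 ≤ dist2 b' a' ^ 2 := by
      have := dist2_nonneg a b
      gcongr
    rw [dist2_sq] at h3
    nlinarith

theorem measurable_dist2 {p : ℕ} {α : Type*} [MeasurableSpace α] {f g : α → Fin p → ℝ}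
    (hf : Measurable f) (hg : Measurable g) : Measurable fun ω => dist2 (f ω) (g ω) := by
  simp only [dist2_eq_sqrt]
  have h1 : ∀ j, Measurable fun ω => f ω j := fun j => (measurable_pi_apply j).comp hf
  have h2 : ∀ j, Measurable fun ω => g ω j := fun j => (measurable_pi_apply j).comp hg
  fun_prop

theorem measurable_substitute {K p : ℕ} {α : Type*} [MeasurableSpace α]
    {sel : (Fin K → ℝ) → Fin K} (hsel : Measurable sel) {m : α → Fin K → Fin p → ℝ}
    {x : α → Fin p → ℝ} (hm : Measurable m) (hx : Measurable x) :
    Measurable fun ω => substitute sel (m ω) (x ω) := by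
  refine hsel.comp (measurable_pi_lambda _ fun v => ?_)
  exact measurable_dist2 hx ((measurable_pi_apply v).comp hm)

theorem aemeasurable_substitute {K p : ℕ} {α : Type*} [MeasurableSpace α] {Q : Measure α}
    {sel : (Fin K → ℝ) → Fin K} (hsel : Measurable sel) {m : α → Fin K → Fin p → ℝ}
    {x : α → Fin p → ℝ} (hm : AEMeasurable m Q) (hx : AEMeasurable x Q) :
    AEMeasurable (fun ω => substitute sel (m ω) (x ω)) Q := by
  have h : Measurable fun s : (Fin K → Fin p → ℝ) × (Fin p → ℝ) => substitute sel s.1 s.2 := by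
    refine measurable_substitute hsel ?_ ?_
    · fun_prop
    · fun_prop
  have h1 := h.comp_aemeasurable (hm.prodMk hx)
  exact h1

end Geometry

section Tails

variable {Ω₀ : Type*} [MeasurableSpace Ω₀] {K : ℕ} {P : Measure Ω₀} {X : ℕ → Ω₀ → ℝ}
  {Z : Ω₀ → Fin K}

/-- `T L` bounds, uniformly over the components and over the directions `w` with `L ≤ ‖w‖²`, the
conditional probability that the component of `X_{1:p} - μ_{1:p}(z)` in the direction `w` is at
least `3/8 ‖w‖`. -/
def IsTailBound (P : Measure Ω₀) (X : ℕ → Ω₀ → ℝ) (Z : Ω₀ → Fin K) (T : ℝ → ℝ≥0∞) : Prop :=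
  ∀ (z : Fin K) (p : ℕ) (w : Fin p → ℝ) (L : ℝ), 0 < L → L ≤ ∑ j, w j ^ 2 →
    P[|Z ← z] {ω | 3 / 8 * ∑ j, w j ^ 2 ≤ ∑ j : Fin p, (X j ω - condMean P X Z j z) * w j} ≤ T L

theorem isProbabilityMeasure_cond [IsFiniteMeasure P] (h : IsMixtureModel P X Z) (z : Fin K) :
    IsProbabilityMeasure (P[|Z ← z]) :=
  cond_isProbabilityMeasure (h.weight_pos z).ne'

/-- Chebyshev's inequality, as a tail bound. -/
theorem exists_isTailBound_chebyshev [IsFiniteMeasure P] (h : IsMixtureModel P X Z) :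
    ∃ C : ℝ, 0 < C ∧ IsTailBound P X Z (fun L => ENNReal.ofReal (C / L)) := by
  obtain ⟨sMin, sMax, hpos, hle, hs⟩ := h.variance_bounds
  have hsM : 0 < sMax := hpos.trans_le hle
  refine ⟨8 * sMax, by positivity, fun z p w L hL hLw => ?_⟩
  have := isProbabilityMeasure_cond h z
  set S := ∑ j, w j ^ 2 with hS
  have hSpos : 0 < S := hL.trans_le hLw
  let W : Fin p → Ω₀ → ℝ := fun j ω => w j * X j ω
  have hW : ∀ j, MemLp (W j) 2 (P[|Z ← z]) := fun j => (h.memLp_two j z).const_mul (w j)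
  have hsum : MemLp (∑ j, W j) 2 (P[|Z ← z]) := memLp_finsetSum' _ fun j _ => hW j
  have hind : iIndepFun W (P[|Z ← z]) :=
    ((h.condIndep z).precomp Fin.val_injective).comp (fun j t => w j * t) (fun j => by fun_prop)
  have hvar : Var[∑ j, W j; P[|Z ← z]] ≤ sMax * S := by
    rw [IndepFun.variance_sum (fun j _ => hW j) fun j _ k _ hjk => hind.indepFun hjk, hS,
      Finset.mul_sum]
    refine Finset.sum_le_sum fun j _ => ?_
    simp only [W]
    rw [variance_const_mul, mul_comm]
    gcongr
    exact (le_ciSup (f := fun v => condVariance P X Z j v) (Set.finite_range _).bddAbove z).trans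
      (hs j).2
  have hmean : ∫ ω, (∑ j, W j) ω ∂(P[|Z ← z]) = ∑ j, w j * condMean P X Z j z := by
    simp only [Finset.sum_apply]
    rw [integral_finsetSum _ fun j _ => (hW j).integrable (by norm_num)]
    simp only [W, integral_const_mul, condMean]
  have h1 := meas_ge_le_variance_div_sq hsum (c := 3 / 8 * S) (by positivity)
  refine (measure_mono fun ω hω => ?_).trans (h1.trans (ENNReal.ofReal_le_ofReal ?_))
  · simp only [Set.mem_ofPred_eq] at hω ⊢
    rw [hmean, Finset.sum_apply, ← Finset.sum_sub_distrib]
    refine hω.trans (le_trans (le_of_eq ?_) (le_abs_self _))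
    refine Finset.sum_congr rfl fun j _ => ?_
    simp only [W]
    ring
  · calc Var[∑ j, W j; P[|Z ← z]] / (3 / 8 * S) ^ 2 ≤ sMax * S / (3 / 8 * S) ^ 2 := by gcongr
      _ = 64 / 9 * sMax / S := by field_simp; norm_num
      _ ≤ 8 * sMax / L := by gcongr; norm_num

/-- The Chernoff bound, as a tail bound. -/
theorem exists_isTailBound_subgaussian [IsFiniteMeasure P] (h : IsMixtureModel P X Z)
    (hsub : IsUniformlySubGaussian P X Z) :
    ∃ C : ℝ, 0 < C ∧ IsTailBound P X Z (fun L => ENNReal.ofReal (Real.exp (-(C * L)))) := by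
  obtain ⟨c, hc⟩ := hsub
  refine ⟨1 / (16 * (c + 1)), by positivity, fun z p w L hL hLw => ?_⟩
  have := isProbabilityMeasure_cond h z
  set S := ∑ j, w j ^ 2 with hS
  have hSpos : 0 < S := hL.trans_le hLw
  -- A positive variance factor avoids the value `x / 0 = 0` in the exponent.
  have hc1 : ∀ j, HasSubgaussianMGF (fun ω => X j ω - condMean P X Z j z) (c + 1)
      (P[|Z ← z]) := fun j =>
    ⟨(hc j z).integrable_exp_mul, fun t => ((hc j z).mgf_le t).trans (by
      push_cast
      gcongr
      linarith)⟩
  have hind : iIndepFun (fun (j : Fin p) ω => w j * (X j ω - condMean P X Z j z)) (P[|Z ← z]) :=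
    ((h.condIndep z).precomp Fin.val_injective).comp
      (fun j t => w j * (t - condMean P X Z j z)) (fun j => by fun_prop)
  have h1 := HasSubgaussianMGF.measure_sum_ge_le_of_iIndepFun hind
    (c := fun j => NNReal.mk (w j ^ 2) (sq_nonneg _) * (c + 1)) (s := Finset.univ)
    (fun j _ => (hc1 j).const_mul (w j)) (ε := 3 / 8 * S) (by positivity)
  have h2 : ((∑ j, NNReal.mk (w j ^ 2) (sq_nonneg _) * (c + 1) : ℝ≥0) : ℝ) = S * (c + 1) := by
    rw [← Finset.sum_mul, NNReal.coe_mul, NNReal.coe_sum]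
    simp [hS]
  rw [h2] at h1
  have h3 : (3 / 8 * S) ^ 2 / (2 * (S * ((c : ℝ) + 1))) = 9 / 8 * (1 / (16 * (c + 1)) * S) := by
    field_simp
    norm_num
  rw [neg_div, h3] at h1
  rw [← ofReal_measureReal]
  refine ENNReal.ofReal_le_ofReal (le_trans (le_of_eq ?_) (h1.trans (Real.exp_le_exp.2 ?_)))
  · simp only [mul_comm]
  · have : 1 / (16 * ((c : ℝ) + 1)) * L ≤ 1 / (16 * (c + 1)) * S := by gcongr
    have : 0 ≤ 1 / (16 * ((c : ℝ) + 1)) * S := by positivity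
    linarith

/-- With fixed centers that have small relative errors, the substitute differs from the latent
variable with small probability. -/
theorem measure_substitute_ne_le [IsProbabilityMeasure P] (hZ : Measurable Z) {T : ℝ → ℝ≥0∞}
    (hT : IsTailBound P X Z T) {sel : (Fin K → ℝ) → Fin K} (hsel : IsArgminRule sel) {p : ℕ}
    {m : Fin K → Fin p → ℝ}
    (hm : ∀ u v, v ≠ u → relError (meanVec P X Z p) m u v ≤ 1 / 10) {L : ℝ} (hL : 0 < L)
    (hsep : ∀ u v, v ≠ u → L ≤ dist2 (meanVec P X Z p u) (meanVec P X Z p v) ^ 2) :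
    P {ω | substitute sel m (fun j : Fin p => X j ω) ≠ Z ω} ≤ K * K * T (16 / 25 * L) := by
  let E : Fin K → Fin K → Set Ω₀ := fun u v =>
    {ω | Z ω = u ∧ v ≠ u ∧
      dist2 (fun j : Fin p => X j ω) (m v) ≤ dist2 (fun j : Fin p => X j ω) (m u)}
  have hE : ∀ u v, P (E u v) ≤ T (16 / 25 * L) := by
    intro u v
    by_cases hvu : v = u
    · have : E u v = ∅ := Set.eq_empty_of_forall_notMem fun ω hω => hω.2.1 hvu
      simp [this]
    have hD : 0 < dist2 (meanVec P X Z p u) (meanVec P X Z p v) :=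
      (dist2_nonneg _ _).lt_of_ne' fun h0 => absurd (hsep u v hvu) (by rw [h0]; simpa using hL)
    let w : Fin p → ℝ := fun j => m v j - m u j
    by_cases hw : 16 / 25 * L ≤ ∑ j, w j ^ 2
    · have h1 := hT u p w (16 / 25 * L) (by positivity) hw
      refine le_trans ?_ h1
      have hms : MeasurableSet (Z ⁻¹' {u}) := hZ (measurableSet_singleton u)
      calc P (E u v) ≤ P (Z ⁻¹' {u} ∩
            {ω | 3 / 8 * ∑ j, w j ^ 2 ≤ ∑ j : Fin p, (X j ω - condMean P X Z j u) * w j}) := by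
            refine measure_mono fun ω hω => ⟨hω.1, ?_⟩
            exact (sum_mul_ge_of_dist2_le hD (hm u v hvu) (hm v u (Ne.symm hvu)) hω.2.2).1
        _ = _ * P (Z ⁻¹' {u}) := (cond_mul_eq_inter hms _ P).symm
        _ ≤ _ := mul_le_of_le_one_right zero_le prob_le_one
    · have : E u v = ∅ := by
        refine Set.eq_empty_of_forall_notMem fun ω hω => hw ?_
        refine le_trans ?_
          (sum_mul_ge_of_dist2_le hD (hm u v hvu) (hm v u (Ne.symm hvu)) hω.2.2).2
        have := hsep u v hvu
        gcongr
      simp [this]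
  calc P {ω | substitute sel m (fun j : Fin p => X j ω) ≠ Z ω} ≤ P (⋃ u, ⋃ v, E u v) := by
        refine measure_mono fun ω hω => ?_
        simp only [Set.mem_iUnion]
        exact ⟨Z ω, _, rfl, hω, hsel.2 (fun v => dist2 (fun j : Fin p => X j ω) (m v)) _⟩
    _ ≤ ∑ u, ∑ v, P (E u v) := (measure_iUnion_fintype_le _ _).trans
        (Finset.sum_le_sum fun u _ => measure_iUnion_fintype_le _ _)
    _ ≤ ∑ u : Fin K, ∑ v : Fin K, T (16 / 25 * L) :=
        Finset.sum_le_sum fun u _ => Finset.sum_le_sum fun v _ => hE u v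
    _ = K * K * T (16 / 25 * L) := by simp [mul_assoc]

end Tails

section Data

variable {Ω₀ Ω : Type*} [MeasurableSpace Ω₀] [MeasurableSpace Ω] {K : ℕ} {P : Measure Ω₀}
  [IsProbabilityMeasure P] {Q : Measure Ω} [IsProbabilityMeasure Q] {X : ℕ → Ω₀ → ℝ}
  {Z : Ω₀ → Fin K} {Y : Ω₀ → ℝ}

/-- The probability of recovering the wrong latent value is at most the probability that the
estimated centers are bad plus the probability of a large deviation. -/
theorem measure_substitute_ne_le_of_isData (h : IsMixtureModel P X Z) {T : ℝ → ℝ≥0∞}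
    (hT : IsTailBound P X Z T) {sel : (Fin K → ℝ) → Fin K} (hsel : IsArgminRule sel) {n m p : ℕ}
    {est : (Fin m → Fin p → ℝ) → Fin K → Fin p → ℝ} (hest : Measurable est)
    {xs₀ : Fin m → Ω → Fin p → ℝ} {xs : Fin n → Ω → Fin p → ℝ} {z : Fin n → Ω → Fin K}
    {y : Fin n → Ω → ℝ} (hdata : IsData P X Z Y Q n m p xs₀ xs z y) {L : ℝ} (hL : 0 < L)
    (hsep : ENNReal.ofReal L ≤ sep P X Z p) (k : Fin n) :
    Q {ω | substitute sel (est fun l => xs₀ l ω) (xs k ω) ≠ z k ω} ≤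
      (∑ u, ∑ v, if v ≠ u then
        Q {ω | 1 / 10 < relError (meanVec P X Z p) (est fun l => xs₀ l ω) u v} else 0) +
      K * K * T (16 / 25 * L) := by
  have hsep' : ∀ u v, v ≠ u → L ≤ dist2 (meanVec P X Z p u) (meanVec P X Z p v) ^ 2 := by
    intro u v hvu
    have h1 : sep P X Z p ≤
        ENNReal.ofReal (dist2 (meanVec P X Z p u) (meanVec P X Z p v) ^ 2) :=
      iInf_le_of_le u (iInf_le_of_le v (iInf_le _ hvu))
    exact (ENNReal.ofReal_le_ofReal_iff (sq_nonneg _)).1 (hsep.trans h1)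
  have hU0 : AEMeasurable (fun ω l => xs₀ l ω) Q :=
    aemeasurable_pi_lambda _ fun l => (hdata.identDistrib₀ l).aemeasurable_fst
  have hU : AEMeasurable (fun ω => est fun l => xs₀ l ω) Q := hest.comp_aemeasurable hU0
  have hid := (hdata.identDistrib k).comp (u := fun s : (Fin p → ℝ) × Fin K × ℝ => (s.1, s.2.1))
    (by fun_prop)
  have hUV : IndepFun (fun ω => est fun l => xs₀ l ω) (fun ω => (xs k ω, z k ω)) Q :=
    hdata.indepFun.comp (φ := est)
      (ψ := fun s : Fin n → (Fin p → ℝ) × Fin K × ℝ => ((s k).1, (s k).2.1)) hest (by fun_prop)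
  let G : Set (Fin K → Fin p → ℝ) :=
    {c | ∀ u v, v ≠ u → relError (meanVec P X Z p) c u v ≤ 1 / 10}
  have hG : MeasurableSet G := by
    have : G = ⋂ u, ⋂ v, ⋂ (_ : v ≠ u), {c | relError (meanVec P X Z p) c u v ≤ 1 / 10} := by
      ext c
      simp [G]
    rw [this]
    refine MeasurableSet.iInter fun u => MeasurableSet.iInter fun v => MeasurableSet.iInter fun _ =>
      measurableSet_le ?_ measurable_const
    exact (measurable_dist2 measurable_const (measurable_pi_apply u)).div_const _
  let A : Set ((Fin K → Fin p → ℝ) × (Fin p → ℝ) × Fin K) :=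
    {s | s.1 ∈ G ∧ substitute sel s.1 s.2.1 ≠ s.2.2}
  have hA : MeasurableSet A := by
    refine (measurable_fst hG).inter (measurableSet_eq_fun ?_ (by fun_prop)).compl
    exact measurable_substitute hsel.1 measurable_fst (by fun_prop)
  have hXm := h.measurable_X
  have hZm := h.measurable_Z
  have hfreeze := measure_le_of_indepFun (C := K * K * T (16 / 25 * L)) hU hid.aemeasurable_fst
    hUV hA (fun c => by
      rw [hid.map_eq]
      refine (Measure.map_apply (f := fun ω => ((fun j : Fin p => X j ω), Z ω)) (by fun_prop)
        (measurable_prodMk_left hA)).le.trans ?_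
      by_cases hc : c ∈ G
      · refine (measure_mono fun ω hω => ?_).trans
          (measure_substitute_ne_le h.measurable_Z hT hsel hc hL hsep')
        exact hω.2
      · refine (measure_mono_null (t := ∅) (fun ω hω => hc hω.1) (by simp)).le.trans zero_le)
  calc Q {ω | substitute sel (est fun l => xs₀ l ω) (xs k ω) ≠ z k ω}
      ≤ Q ((⋃ u, ⋃ v, {ω | v ≠ u ∧
            1 / 10 < relError (meanVec P X Z p) (est fun l => xs₀ l ω) u v}) ∪
          {ω | ((est fun l => xs₀ l ω), (xs k ω, z k ω)) ∈ A}) := by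
        refine measure_mono fun ω hω => ?_
        by_cases hg : (est fun l => xs₀ l ω) ∈ G
        · exact Or.inr ⟨hg, hω⟩
        · left
          simp only [G, Set.mem_ofPred_eq, not_forall, not_le] at hg
          obtain ⟨u, v, hvu, huv⟩ := hg
          exact Set.mem_iUnion₂.2 ⟨u, v, hvu, huv⟩
    _ ≤ _ := by
        refine (measure_union_le _ _).trans (add_le_add ?_ hfreeze)
        refine (measure_iUnion_fintype_le _ _).trans (Finset.sum_le_sum fun u _ =>
          (measure_iUnion_fintype_le _ _).trans (Finset.sum_le_sum fun v _ => ?_))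
        by_cases hvu : v = u <;> simp [hvu]

end Data

/-! ### Conditioning on the latent variable -/

section Conditioning

theorem ite_fiber_eq_indicator {α : Type*} {K : ℕ} {Z : α → Fin K} (f : α → ℝ) (v : Fin K) :
    (fun ω => if Z ω = v then f ω else 0) = (Z ⁻¹' {v}).indicator f := by
  ext ω
  by_cases h : Z ω = v <;> simp [h]

variable {Ω₀ : Type*} [MeasurableSpace Ω₀] {K : ℕ} {P : Measure Ω₀} {Z : Ω₀ → Fin K}

theorem ae_cond_eq (hZ : Measurable Z) (v : Fin K) : ∀ᵐ ω ∂(P[|Z ← v]), Z ω = v :=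
  ae_cond_of_forall_mem (hZ (measurableSet_singleton v)) fun _ h => h

theorem memLp_cond {f : Ω₀ → ℝ} {q : ℝ≥0∞} (hw : ∀ v, 0 < P (Z ⁻¹' {v})) (hf : MemLp f q P)
    (v : Fin K) : MemLp f q (P[|Z ← v]) :=
  hf.restrict _ |>.smul_measure (ENNReal.inv_ne_top.2 (hw v).ne')

theorem memLp_ite_fiber (hZ : Measurable Z) {f : Ω₀ → ℝ} {q : ℝ≥0∞} (hf : MemLp f q P)
    (v : Fin K) : MemLp (fun ω => if Z ω = v then f ω else 0) q P := by
  rw [ite_fiber_eq_indicator]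
  exact hf.indicator (hZ (measurableSet_singleton v))

variable [IsProbabilityMeasure P]

theorem restrict_fiber_eq (hw : ∀ v, 0 < P (Z ⁻¹' {v})) (v : Fin K) :
    P.restrict (Z ⁻¹' {v}) = P (Z ⁻¹' {v}) • P[|Z ← v] := by
  rw [ProbabilityTheory.cond, smul_smul,
    ENNReal.mul_inv_cancel (hw v).ne' (measure_ne_top _ _), one_smul]

theorem setIntegral_fiber (hw : ∀ v, 0 < P (Z ⁻¹' {v})) (f : Ω₀ → ℝ) (v : Fin K) :
    ∫ ω in Z ⁻¹' {v}, f ω ∂P = P.real (Z ⁻¹' {v}) * ∫ ω, f ω ∂(P[|Z ← v]) := by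
  rw [restrict_fiber_eq hw, integral_smul_measure, smul_eq_mul, measureReal_def]

theorem integral_ite_fiber (hZ : Measurable Z) (hw : ∀ v, 0 < P (Z ⁻¹' {v})) (f : Ω₀ → ℝ)
    (v : Fin K) :
    ∫ ω, (if Z ω = v then f ω else 0) ∂P = P.real (Z ⁻¹' {v}) * ∫ ω, f ω ∂(P[|Z ← v]) := by
  rw [← setIntegral_fiber hw, ← integral_indicator (hZ (measurableSet_singleton v)),
    ite_fiber_eq_indicator]

theorem memLp_of_memLp_cond (hZ : Measurable Z) (hw : ∀ v, 0 < P (Z ⁻¹' {v})) {f : Ω₀ → ℝ}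
    {q : ℝ≥0∞} (hf : ∀ v, MemLp f q (P[|Z ← v])) : MemLp f q P := by
  have h1 : ∀ v, MemLp (fun ω => if Z ω = v then f ω else 0) q P := by
    intro v
    rw [ite_fiber_eq_indicator, memLp_indicator_iff_restrict (hZ (measurableSet_singleton v)),
      restrict_fiber_eq hw]
    exact (hf v).smul_measure (measure_ne_top _ _)
  simpa using memLp_finsetSum Finset.univ fun v _ => h1 v

theorem integral_eq_sum_cond (hZ : Measurable Z) (hw : ∀ v, 0 < P (Z ⁻¹' {v})) {f : Ω₀ → ℝ}
    (hf : Integrable f P) :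
    ∫ ω, f ω ∂P = ∑ v, P.real (Z ⁻¹' {v}) * ∫ ω, f ω ∂(P[|Z ← v]) := by
  simp only [← integral_ite_fiber hZ hw]
  rw [← integral_finsetSum]
  · simp
  · intro v _
    exact memLp_one_iff_integrable.1 (memLp_ite_fiber hZ (memLp_one_iff_integrable.2 hf) v)

theorem memLp_comp_fiber (hZ : Measurable Z) (φ : Fin K → ℝ) {q : ℝ≥0∞} :
    MemLp (fun ω => φ (Z ω)) q P :=
  MemLp.of_bound (Measurable.aestronglyMeasurable (by fun_prop)) (∑ v, |φ v|)
    (ae_of_all _ fun ω => by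
      rw [Real.norm_eq_abs]
      exact Finset.single_le_sum (f := fun v => |φ v|) (fun v _ => abs_nonneg _)
        (Finset.mem_univ (Z ω)))

theorem integral_comp_fiber (hZ : Measurable Z) (hw : ∀ v, 0 < P (Z ⁻¹' {v})) (φ : Fin K → ℝ) :
    ∫ ω, φ (Z ω) ∂P = ∑ v, P.real (Z ⁻¹' {v}) * φ v := by
  rw [integral_eq_sum_cond hZ hw (memLp_one_iff_integrable.1 (memLp_comp_fiber hZ φ))]
  refine Finset.sum_congr rfl fun v _ => ?_
  have := cond_isProbabilityMeasure (hw v).ne'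
  rw [integral_congr_ae ((ae_cond_eq hZ v).mono fun ω h => by
    simpa using congrArg φ h : (fun ω => φ (Z ω)) =ᵐ[P[|Z ← v]] fun _ => φ v)]
  simp

/-- The limit of the within-group sample covariance is the mean conditional covariance. -/
theorem integral_covariance_fiber (hZ : Measurable Z) (hw : ∀ v, 0 < P (Z ⁻¹' {v}))
    {f g : Ω₀ → ℝ} (hf : MemLp f 2 P) (hg : MemLp g 2 P) :
    ∫ ω, cov[f, g; P[|Z ← Z ω]] ∂P =
      ∫ ω, f ω * g ω ∂P - ∑ v, (∫ ω, (if Z ω = v then f ω else 0) ∂P) *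
        (∫ ω, (if Z ω = v then g ω else 0) ∂P) / P.real (Z ⁻¹' {v}) := by
  rw [integral_comp_fiber hZ hw fun v => cov[f, g; P[|Z ← v]],
    integral_eq_sum_cond hZ hw (f := fun ω => f ω * g ω) (hf.integrable_mul hg),
    ← Finset.sum_sub_distrib]
  refine Finset.sum_congr rfl fun v _ => ?_
  have := cond_isProbabilityMeasure (hw v).ne'
  have hp : P.real (Z ⁻¹' {v}) ≠ 0 := (ENNReal.toReal_pos (hw v).ne' (measure_ne_top _ _)).ne'
  rw [integral_ite_fiber hZ hw, integral_ite_fiber hZ hw,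
    covariance_eq_sub (memLp_cond hw hf v) (memLp_cond hw hg v)]
  simp only [Pi.mul_apply]
  field_simp

theorem integral_centered_ite_fiber (hZ : Measurable Z) (hw : ∀ v, 0 < P (Z ⁻¹' {v}))
    {f : Ω₀ → ℝ} (hf : Integrable f P) (v : Fin K) :
    ∫ ω, (if Z ω = v then f ω - ∫ ω', f ω' ∂(P[|Z ← Z ω]) else 0) ∂P = 0 := by
  have := cond_isProbabilityMeasure (hw v).ne'
  rw [integral_ite_fiber hZ hw fun ω => f ω - ∫ ω', f ω' ∂(P[|Z ← Z ω]),
    integral_congr_ae ((ae_cond_eq hZ v).mono fun ω h => by simp only [h] :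
      (fun ω => f ω - ∫ ω', f ω' ∂(P[|Z ← Z ω])) =ᵐ[P[|Z ← v]]
        fun ω => f ω - ∫ ω', f ω' ∂(P[|Z ← v])),
    integral_sub (memLp_one_iff_integrable.1 (memLp_cond hw (memLp_one_iff_integrable.2 hf) v))
      (integrable_const _)]
  simp

/-- The covariance of the residuals after centering in every group. -/
theorem integral_centered_mul_centered (hZ : Measurable Z) (hw : ∀ v, 0 < P (Z ⁻¹' {v}))
    {f g : Ω₀ → ℝ} (hf : MemLp f 2 P) (hg : MemLp g 2 P) :
    ∫ ω, (f ω - ∫ ω', f ω' ∂(P[|Z ← Z ω])) * (g ω - ∫ ω', g ω' ∂(P[|Z ← Z ω])) ∂P =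
      ∫ ω, cov[f, g; P[|Z ← Z ω]] ∂P := by
  rw [integral_comp_fiber hZ hw fun v => cov[f, g; P[|Z ← v]], integral_eq_sum_cond hZ hw
    (f := fun ω => (f ω - ∫ ω', f ω' ∂(P[|Z ← Z ω])) * (g ω - ∫ ω', g ω' ∂(P[|Z ← Z ω])))
    ((hf.sub (memLp_comp_fiber hZ fun v => ∫ ω', f ω' ∂(P[|Z ← v]))).integrable_mul
      (hg.sub (memLp_comp_fiber hZ fun v => ∫ ω', g ω' ∂(P[|Z ← v]))))]
  refine Finset.sum_congr rfl fun v _ => ?_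
  rw [covariance]
  congr 1
  exact integral_congr_ae ((ae_cond_eq hZ v).mono fun ω h => by simp [h])

end Conditioning

section Model

variable {Ω₀ : Type*} [MeasurableSpace Ω₀] {K : ℕ} {P : Measure Ω₀} {X : ℕ → Ω₀ → ℝ}
  {Z : Ω₀ → Fin K}

theorem memLp_X [IsProbabilityMeasure P] (h : IsMixtureModel P X Z) (i : ℕ) : MemLp (X i) 2 P :=
  memLp_of_memLp_cond h.measurable_Z h.weight_pos (h.memLp_two i)

theorem meanCondVariance_eq (h : IsMixtureModel P X Z) (i : ℕ) :
    meanCondVariance P X Z i = ∫ ω, cov[X i, X i; P[|Z ← Z ω]] ∂P := by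
  unfold meanCondVariance condVariance
  simp only [covariance_self (h.measurable_X i).aemeasurable]

theorem meanCondVariance_pos [IsProbabilityMeasure P] (h : IsMixtureModel P X Z) (i : ℕ) :
    0 < meanCondVariance P X Z i := by
  obtain ⟨sMin, sMax, hpos, -, hs⟩ := h.variance_bounds
  have hΩ : Nonempty Ω₀ := Measure.nonempty_of_neZero P
  have : Nonempty (Fin K) := hΩ.map Z
  obtain ⟨v, hv⟩ := exists_eq_ciSup_of_finite (f := fun v => condVariance P X Z i v)
  have hvpos : 0 < condVariance P X Z i v := by
    rw [hv]
    exact hpos.trans_le (hs i).1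
  have h1 : meanCondVariance P X Z i = _ :=
    integral_comp_fiber h.measurable_Z h.weight_pos (fun v => condVariance P X Z i v)
  rw [h1]
  refine Finset.sum_pos' (fun u _ => mul_nonneg measureReal_nonneg (variance_nonneg _ _))
    ⟨v, Finset.mem_univ v, mul_pos ?_ hvpos⟩
  exact ENNReal.toReal_pos (h.weight_pos v).ne' (measure_ne_top _ _)

end Model

/-! ### Asymptotics of the least squares estimator -/

section Oracle

theorem labelMean_eq {S : Type*} {n K : ℕ} (l : S → Fin K) (f : S → ℝ) (s : Fin n → S)
    (v : Fin K) : labelMean (fun k => l (s k)) (fun k => f (s k)) v =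
      (∑ k, (fun t => if l t = v then f t else 0) (s k)) / n := by
  rw [labelMean, Finset.sum_filter]

variable {Ω₀ Ω S : Type*} [MeasurableSpace Ω₀] [MeasurableSpace Ω] [MeasurableSpace S] {K : ℕ}
  {P : Measure Ω₀} [IsProbabilityMeasure P] {Q : Measure Ω}
  {n : ℕ → ℕ} {u : ∀ r, Fin (n r) → Ω → S} {W : Ω₀ → S} {l : S → Fin K} {f g : S → ℝ}

theorem measurable_ite_label (hl : Measurable l) (hf : Measurable f) (v : Fin K) :
    Measurable fun s => if l s = v then f s else 0 :=
  Measurable.ite (measurableSet_eq_fun hl measurable_const) hf measurable_const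

theorem tendstoInMeasure_labelMean (hn : Tendsto n atTop atTop)
    (hid : ∀ r k, IdentDistrib (u r k) W Q P) (hind : ∀ r, iIndepFun (u r) Q)
    (hl : Measurable l) (hlW : Measurable fun ω => l (W ω)) (hf : Measurable f)
    (hfW : Integrable (fun ω => f (W ω)) P) (v : Fin K) :
    TendstoInMeasure Q (fun r ω => labelMean (fun k => l (u r k ω)) (fun k => f (u r k ω)) v)
      atTop (fun _ => ∫ ω, (if l (W ω) = v then f (W ω) else 0) ∂P) := by
  have hm := measurable_ite_label hl hf v
  simp only [labelMean_eq l]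
  exact tendstoInMeasure_row_mean hn
    (memLp_one_iff_integrable.1 (memLp_ite_fiber hlW (memLp_one_iff_integrable.2 hfW) v))
    (fun r k => (hid r k).comp hm) (fun r => (hind r).comp (fun _ => _) (fun _ => hm))

/-- The within-group sample covariance is consistent for the mean conditional covariance, also if
the labels are wrong with a probability that tends to zero. -/
theorem tendstoInMeasure_withinCov_of_labels (hn : Tendsto n atTop atTop)
    (hid : ∀ r k, IdentDistrib (u r k) W Q P) (hind : ∀ r, iIndepFun (u r) Q)
    (hl : Measurable l) (hlW : Measurable fun ω => l (W ω))
    (hw : ∀ v, 0 < P ((fun ω => l (W ω)) ⁻¹' {v})) (hf : Measurable f) (hg : Measurable g)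
    (hfW : MemLp (fun ω => f (W ω)) 2 P) (hgW : MemLp (fun ω => g (W ω)) 2 P)
    {l' : ∀ r, Fin (n r) → Ω → Fin K} (hl' : ∀ r k, AEMeasurable (l' r k) Q) {α : ℕ → ℝ≥0∞}
    (hα : ∀ r k, Q {ω | l' r k ω ≠ l (u r k ω)} ≤ α r) (hα0 : Tendsto α atTop (𝓝 0)) :
    TendstoInMeasure Q (fun r ω => withinCov (fun k => l' r k ω) (fun k => f (u r k ω))
      (fun k => g (u r k ω))) atTop (fun _ => ∫ ω,
        cov[fun ω' => f (W ω'), fun ω' => g (W ω');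
          P[|(fun ω' => l (W ω')) ← l (W ω)]] ∂P) := by
  have hum : ∀ r k, AEMeasurable (u r k) Q := fun r k => (hid r k).aemeasurable_fst
  have key : ∀ {e : S → ℝ}, Measurable e → MemLp (fun ω => e (W ω)) 2 P → ∀ v,
      TendstoInMeasure Q (fun r ω => labelMean (fun k => l' r k ω) (fun k => e (u r k ω)) v)
        atTop (fun _ => ∫ ω, (if l (W ω) = v then e (W ω) else 0) ∂P) := by
    intro e he heW v
    have h1 := tendstoInMeasure_labelMean hn hid hind hl hlW he (heW.integrable (by norm_num)) v
    have h2 := tendstoInMeasure_labelMean_sub (l := fun r k ω => l (u r k ω)) (l' := l')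
      (a := fun r k ω => e (u r k ω)) (fun r k => hl.comp_aemeasurable (hum r k)) hl'
      (fun r k => he.comp_aemeasurable (hum r k)) (M := ∫⁻ ω, ‖e (W ω)‖ₑ ^ 2 ∂P)
      (by
        have := heW.eLpNorm_lt_top
        rw [eLpNorm_lt_top_iff_lintegral_rpow_enorm_lt_top (by norm_num) (by norm_num)] at this
        simpa using this.ne)
      (fun r k => ((hid r k).comp (u := fun s => ‖e s‖ₑ ^ 2) (by fun_prop)).lintegral_eq.le)
      hα hα0 v
    have h3 := tendstoInMeasure_add h2 h1
    simpa using h3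
  rw [integral_covariance_fiber hlW hw hfW hgW]
  refine tendstoInMeasure_withinCov (a := fun r k ω => f (u r k ω))
    (b := fun r k ω => g (u r k ω)) (fun v => ?_) ?_ (key hf hfW) (key hg hgW) (fun v => ?_)
  · exact (ENNReal.toReal_pos (hw v).ne' (measure_ne_top _ _)).ne'
  · exact tendstoInMeasure_row_mean hn (hfW.integrable_mul hgW)
      (fun r k => (hid r k).comp (hf.mul hg))
      (fun r => (hind r).comp (fun _ => _) (fun _ => hf.mul hg))
  · have h1 := key (e := fun _ => 1) measurable_const (memLp_const 1) v
    rw [integral_ite_fiber hlW hw (fun _ => (1 : ℝ)) v] at h1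
    have := cond_isProbabilityMeasure (hw v).ne'
    simpa using h1

/-- Consistency of the least squares estimator, also if the labels are wrong with a probability
that tends to zero. -/
theorem tendstoInMeasure_betaOLS_of_labels (hn : Tendsto n atTop atTop)
    (hid : ∀ r k, IdentDistrib (u r k) W Q P) (hind : ∀ r, iIndepFun (u r) Q)
    (hl : Measurable l) (hlW : Measurable fun ω => l (W ω))
    (hw : ∀ v, 0 < P ((fun ω => l (W ω)) ⁻¹' {v})) (hf : Measurable f) (hg : Measurable g)
    (hfW : MemLp (fun ω => f (W ω)) 2 P) (hgW : MemLp (fun ω => g (W ω)) 2 P)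
    {β V : ℝ} (hV : V ≠ 0)
    (hVeq : ∫ ω, cov[fun ω' => f (W ω'), fun ω' => f (W ω');
          P[|(fun ω' => l (W ω')) ← l (W ω)]] ∂P = V)
    (hβ : ∫ ω, cov[fun ω' => f (W ω'), fun ω' => g (W ω');
          P[|(fun ω' => l (W ω')) ← l (W ω)]] ∂P = β * V)
    {l' : ∀ r, Fin (n r) → Ω → Fin K} (hl' : ∀ r k, AEMeasurable (l' r k) Q) {α : ℕ → ℝ≥0∞}
    (hα : ∀ r k, Q {ω | l' r k ω ≠ l (u r k ω)} ≤ α r) (hα0 : Tendsto α atTop (𝓝 0)) :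
    TendstoInMeasure Q (fun r ω => betaOLS (fun k => l' r k ω) (fun k => f (u r k ω))
      (fun k => g (u r k ω))) atTop (fun _ => β) := by
  have h1 := tendstoInMeasure_withinCov_of_labels hn hid hind hl hlW hw hf hg hfW hgW hl' hα hα0
  have h2 := tendstoInMeasure_withinCov_of_labels hn hid hind hl hlW hw hf hf hfW hfW hl' hα hα0
  rw [hβ] at h1
  rw [hVeq] at h2
  simp only [betaOLS_eq_withinCov_div]
  simpa only [mul_div_cancel_right₀ β hV] using tendstoInMeasure_div hV h1 h2

variable [IsProbabilityMeasure Q]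

/-- The central limit theorem for the within-group sample covariance of variables that are
conditionally centered: replacing the group means by zero has an effect of order `1 / n`. -/
theorem tendstoInDistribution_withinCov (hn : Tendsto n atTop atTop)
    (hid : ∀ r k, IdentDistrib (u r k) W Q P) (hind : ∀ r, iIndepFun (u r) Q)
    (hl : Measurable l) (hlW : Measurable fun ω => l (W ω))
    (hw : ∀ v, 0 < P ((fun ω => l (W ω)) ⁻¹' {v})) (hf : Measurable f) (hg : Measurable g)
    (hfW : MemLp (fun ω => f (W ω)) 2 P) (hgW : MemLp (fun ω => g (W ω)) 2 P)
    (hf0 : ∀ v, ∫ ω, (if l (W ω) = v then f (W ω) else 0) ∂P = 0)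
    (hg0 : ∀ v, ∫ ω, (if l (W ω) = v then g (W ω) else 0) ∂P = 0)
    (hfg : MemLp (fun ω => f (W ω) * g (W ω)) 2 P) (hfg0 : ∫ ω, f (W ω) * g (W ω) ∂P = 0) :
    TendstoInDistribution (fun r ω => √(n r) * withinCov (fun k => l (u r k ω))
      (fun k => f (u r k ω)) (fun k => g (u r k ω))) atTop id (fun _ => Q)
      (gaussianReal 0 (∫ ω, (f (W ω) * g (W ω)) ^ 2 ∂P).toNNReal) := by
  have hum : ∀ r k, AEMeasurable (u r k) Q := fun r k => (hid r k).aemeasurable_fst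
  have h1 := tendstoInDistribution_row_sum (A := fun r k ω => f (u r k ω) * g (u r k ω)) hn hfg hfg0
    (fun r k => (hid r k).comp (hf.mul hg))
    (fun r => (hind r).comp (fun _ => _) (fun _ => hf.mul hg))
  refine tendstoInDistribution_of_tendstoInMeasure_sub _ _ h1 ?_ fun r => ?_
  swap
  · exact (aemeasurable_withinCov (fun k => hl.comp_aemeasurable (hum r k))
      (fun k => hf.comp_aemeasurable (hum r k))
      (fun k => hg.comp_aemeasurable (hum r k))).const_mul _
  have h2 : ∀ v, TendstoInMeasure Q (fun r ω => √(n r) *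
      (labelMean (fun k => l (u r k ω)) (fun k => f (u r k ω)) v *
        labelMean (fun k => l (u r k ω)) (fun k => g (u r k ω)) v)) atTop (fun _ => 0) := by
    intro v
    have hmf := measurable_ite_label hl hf v
    have hmg := measurable_ite_label hl hg v
    simp only [labelMean_eq l]
    exact tendstoInMeasure_row_mean_mul hn (memLp_ite_fiber hlW hfW v) (hf0 v)
      (fun r k => (hid r k).comp hmf) (fun r => (hind r).comp (fun _ => _) (fun _ => hmf))
      (memLp_ite_fiber hlW hgW v) (hg0 v)
      (fun r k => (hid r k).comp hmg) (fun r => (hind r).comp (fun _ => _) (fun _ => hmg))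
  have h3 : ∀ v, TendstoInMeasure Q (fun r ω =>
      labelMean (fun k => l (u r k ω)) (fun _ => 1) v) atTop
        (fun _ => P.real ((fun ω => l (W ω)) ⁻¹' {v})) := by
    intro v
    have h := tendstoInMeasure_labelMean hn hid hind hl hlW (f := fun _ => 1) measurable_const
      (integrable_const 1) v
    rw [integral_ite_fiber hlW hw (fun _ => (1 : ℝ)) v] at h
    have := cond_isProbabilityMeasure (hw v).ne'
    simpa using h
  have h4 := tendstoInMeasure_sum Finset.univ fun v _ =>
    tendstoInMeasure_div (ENNReal.toReal_pos (hw v).ne' (measure_ne_top _ _)).ne' (h2 v) (h3 v)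
  have h5 := tendstoInMeasure_sub (tendstoInMeasure_const (Q := Q) (c := 0)) h4
  simp only [zero_div, Finset.sum_const_zero, sub_zero] at h5
  refine h5.congr_left fun r => ae_of_all _ fun ω => ?_
  have hs : √(n r : ℝ) / n r = (√(n r : ℝ))⁻¹ := by rw [Real.sqrt_div_self', one_div]
  simp only [Pi.sub_apply]
  unfold withinCov
  rw [mul_sub, ← mul_div_assoc, mul_div_right_comm, hs, Finset.mul_sum]
  simp only [mul_div_assoc, Finset.mul_sum]
  ring

theorem tendstoInDistribution_gaussianReal_div {T : ℕ → Ω → ℝ} {s V : ℝ} (hs : 0 ≤ s)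
    (h : TendstoInDistribution T atTop (fun t : ℝ => id t * (1 / V)) (fun _ => Q)
      (gaussianReal 0 s.toNNReal)) :
    TendstoInDistribution T atTop id (fun _ => Q) (gaussianReal 0 (s / V ^ 2).toNNReal) := by
  refine ⟨h.forall_aemeasurable, aemeasurable_id, ?_⟩
  convert! h.tendsto using 2
  refine congrArg 𝓝 (Subtype.ext ?_)
  change (gaussianReal 0 (s / V ^ 2).toNNReal).map id =
    (gaussianReal 0 s.toNNReal).map (fun t => t * (1 / V))
  rw [Measure.map_id, gaussianReal_map_mul_const, mul_zero]
  congr 1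
  ext
  rw [Real.coe_toNNReal _ (by positivity), NNReal.coe_mul, Real.coe_toNNReal _ hs]
  simp
  ring

/-- Asymptotic normality of the least squares estimator with correct labels, with the sandwich
variance. -/
theorem tendstoInDistribution_betaOLS (hn : Tendsto n atTop atTop)
    (hid : ∀ r k, IdentDistrib (u r k) W Q P) (hind : ∀ r, iIndepFun (u r) Q)
    (hl : Measurable l) (hlW : Measurable fun ω => l (W ω))
    (hw : ∀ v, 0 < P ((fun ω => l (W ω)) ⁻¹' {v})) (hf : Measurable f) (hg : Measurable g)
    (hfW : MemLp (fun ω => f (W ω)) 2 P) (hgW : MemLp (fun ω => g (W ω)) 2 P)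
    {c d : Fin K → ℝ} {β V : ℝ} (hV : V ≠ 0)
    (hc : ∀ v, ∫ ω, f (W ω) ∂(P[|(fun ω => l (W ω)) ← v]) = c v)
    (hd : ∀ v, ∫ ω, g (W ω) ∂(P[|(fun ω => l (W ω)) ← v]) = d v)
    (hVeq : ∫ ω, cov[fun ω' => f (W ω'), fun ω' => f (W ω');
          P[|(fun ω' => l (W ω')) ← l (W ω)]] ∂P = V)
    (hβ : ∫ ω, cov[fun ω' => f (W ω'), fun ω' => g (W ω');
          P[|(fun ω' => l (W ω')) ← l (W ω)]] ∂P = β * V)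
    (hscore : MemLp (fun ω => (f (W ω) - c (l (W ω))) *
      (g (W ω) - d (l (W ω)) - β * (f (W ω) - c (l (W ω))))) 2 P) :
    TendstoInDistribution (fun r ω => √(n r) * (betaOLS (fun k => l (u r k ω))
      (fun k => f (u r k ω)) (fun k => g (u r k ω)) - β)) atTop id (fun _ => Q)
      (gaussianReal 0 ((∫ ω, ((f (W ω) - c (l (W ω))) *
        (g (W ω) - d (l (W ω)) - β * (f (W ω) - c (l (W ω))))) ^ 2 ∂P) / V ^ 2).toNNReal) := by
  have hum : ∀ r k, AEMeasurable (u r k) Q := fun r k => (hid r k).aemeasurable_fst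
  set ξ : S → ℝ := fun s => f s - c (l s) with hξ
  set ε : S → ℝ := fun s => g s - d (l s) with hε
  set η : S → ℝ := fun s => g s - d (l s) - β * (f s - c (l s)) with hη
  have hcl : Measurable fun s => c (l s) := (Measurable.of_discrete (f := c)).comp hl
  have hdl : Measurable fun s => d (l s) := (Measurable.of_discrete (f := d)).comp hl
  have hξm : Measurable ξ := hf.sub hcl
  have hηm : Measurable η := (hg.sub hdl).sub (hξm.const_mul β)
  have hξW : MemLp (fun ω => ξ (W ω)) 2 P := hfW.sub (memLp_comp_fiber hlW c)
  have hεW : MemLp (fun ω => ε (W ω)) 2 P := hgW.sub (memLp_comp_fiber hlW d)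
  have hηW : MemLp (fun ω => η (W ω)) 2 P := hεW.sub (hξW.const_mul β)
  have hξ0 : ∀ v, ∫ ω, (if l (W ω) = v then ξ (W ω) else 0) ∂P = 0 := by
    intro v
    simpa only [hc] using integral_centered_ite_fiber hlW hw (hfW.integrable (by norm_num)) v
  have hε0 : ∀ v, ∫ ω, (if l (W ω) = v then ε (W ω) else 0) ∂P = 0 := by
    intro v
    simpa only [hd] using integral_centered_ite_fiber hlW hw (hgW.integrable (by norm_num)) v
  have hη0 : ∀ v, ∫ ω, (if l (W ω) = v then η (W ω) else 0) ∂P = 0 := by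
    intro v
    have h1 : ∀ ω, (if l (W ω) = v then η (W ω) else 0) =
        (if l (W ω) = v then ε (W ω) else 0) - β * (if l (W ω) = v then ξ (W ω) else 0) := by
      intro ω
      split_ifs <;> simp [hη, hξ, hε]
    simp only [h1]
    rw [integral_sub ((memLp_ite_fiber hlW hεW v).integrable (by norm_num))
      (((memLp_ite_fiber hlW hξW v).integrable (by norm_num)).const_mul β), integral_const_mul,
      hξ0, hε0]
    simp
  have hξη0 : ∫ ω, ξ (W ω) * η (W ω) ∂P = 0 := by
    have h1 : ∀ ω, ξ (W ω) * η (W ω) = ξ (W ω) * ε (W ω) - β * (ξ (W ω) * ξ (W ω)) := by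
      intro ω
      simp only [hη, hξ, hε]
      ring
    simp only [h1]
    rw [integral_sub (f := fun ω => ξ (W ω) * ε (W ω)) (g := fun ω => β * (ξ (W ω) * ξ (W ω)))
      (hξW.integrable_mul hεW) ((hξW.integrable_mul hξW).const_mul β), integral_const_mul]
    have h2 := integral_centered_mul_centered hlW hw hfW hgW
    have h3 := integral_centered_mul_centered hlW hw hfW hfW
    simp only [hc, hd] at h2 h3
    rw [hβ] at h2
    rw [hVeq] at h3
    simp only [hξ, hε]
    rw [h2, h3, sub_self]
  have hN := tendstoInDistribution_withinCov hn hid hind hl hlW hw hξm hηm hξW hηW hξ0 hη0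
    hscore hξη0
  have hD := tendstoInMeasure_withinCov_of_labels hn hid hind hl hlW hw hf hf hfW hfW
    (l' := fun r k ω => l (u r k ω)) (fun r k => hl.comp_aemeasurable (hum r k)) (α := fun _ => 0)
    (by simp) tendsto_const_nhds
  rw [hVeq] at hD
  have hDm : ∀ r, AEMeasurable (fun ω => withinCov (fun k => l (u r k ω))
      (fun k => f (u r k ω)) (fun k => f (u r k ω))) Q := fun r =>
    aemeasurable_withinCov (fun k => hl.comp_aemeasurable (hum r k))
      (fun k => hf.comp_aemeasurable (hum r k)) (fun k => hf.comp_aemeasurable (hum r k))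
  have hDinv := tendstoInMeasure_div hV (tendstoInMeasure_const (Q := Q) (c := 1)) hD
  have hprod := hN.continuous_comp_prodMk_of_tendstoInMeasure_const
    (g := fun q : ℝ × ℝ => q.1 * q.2) (by fun_prop) hDinv
    (fun r => aemeasurable_const.div (hDm r))
  -- The estimator differs from this product only where the denominator vanishes.
  have hfin : TendstoInDistribution (fun r ω => √(n r) * (betaOLS (fun k => l (u r k ω))
      (fun k => f (u r k ω)) (fun k => g (u r k ω)) - β)) atTop (fun t : ℝ => id t * (1 / V))
      (fun _ => Q) (gaussianReal 0 (∫ ω, (ξ (W ω) * η (W ω)) ^ 2 ∂P).toNNReal) := by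
    refine tendstoInDistribution_of_tendstoInMeasure_sub _ _ hprod ?_ fun r => ?_
    swap
    · exact ((aemeasurable_betaOLS (fun k => hl.comp_aemeasurable (hum r k))
        (fun k => hf.comp_aemeasurable (hum r k))
        (fun k => hg.comp_aemeasurable (hum r k))).sub_const _).const_mul _
    refine tendstoInMeasure_zero_of_measure_ne ?_
    have h0 := tendstoInMeasure_iff_dist.1 hD |V| (abs_pos.2 hV)
    refine tendsto_of_tendsto_of_tendsto_of_le_of_le tendsto_const_nhds h0 (fun _ => zero_le)
      fun r => measure_mono fun ω hω => ?_
    simp only [Set.mem_ofPred_eq, Pi.sub_apply] at hω ⊢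
    by_contra hlt
    refine hω ?_
    have hne : withinCov (fun k => l (u r k ω))
        (fun k => f (u r k ω)) (fun k => f (u r k ω)) ≠ 0 := by
      intro h0
      rw [h0] at hlt
      simp at hlt
    rw [← withinCov_sub_eq (fun k => l (u r k ω)) (fun k => f (u r k ω))
        (fun k => g (u r k ω)) c d β,
      betaOLS_eq_withinCov_div]
    field_simp
    ring
  exact tendstoInDistribution_gaussianReal_div (integral_nonneg fun ω => sq_nonneg _) hfin

end Oracle

/-! ### Rates for the probability of a wrong label -/

section Rates

theorem tendsto_sep {Ω₀ : Type*} [MeasurableSpace Ω₀] {K : ℕ} {P : Measure Ω₀}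
    {X : ℕ → Ω₀ → ℝ} {Z : Ω₀ → Fin K} (h : IsMixtureModel P X Z) {p : ℕ → ℕ}
    (hp : Tendsto p atTop atTop) : Tendsto (fun r => sep P X Z (p r)) atTop (𝓝 ⊤) := by
  have h1 : ∀ u v, v ≠ u → Tendsto (fun r => ENNReal.ofReal
      (dist2 (meanVec P X Z (p r) u) (meanVec P X Z (p r) v) ^ 2)) atTop (𝓝 ⊤) := by
    intro u v hvu
    have h2 := (ENNReal.tendsto_nat_tsum fun j =>
      ENNReal.ofReal ((condMean P X Z j u - condMean P X Z j v) ^ 2)).comp hp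
    rw [h.separation u v hvu] at h2
    refine h2.congr fun r => ?_
    rw [dist2_sq, ENNReal.ofReal_sum_of_nonneg fun j _ => sq_nonneg _]
    simp [Finset.sum_range, meanVec]
  rw [ENNReal.tendsto_nhds_top_iff_nnreal]
  intro x
  have h2 : ∀ᶠ r in atTop, ∀ u v, v ≠ u → ((x + 1 : ℝ≥0) : ℝ≥0∞) < ENNReal.ofReal
      (dist2 (meanVec P X Z (p r) u) (meanVec P X Z (p r) v) ^ 2) := by
    rw [eventually_all]
    intro u
    rw [eventually_all]
    intro v
    by_cases hvu : v = u
    · simp [hvu]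
    · filter_upwards [ENNReal.tendsto_nhds_top_iff_nnreal.1 (h1 u v hvu) (x + 1)] with r hr _
      exact hr
  filter_upwards [h2] with r hr
  have h3 : (x : ℝ≥0∞) < ((x + 1 : ℝ≥0) : ℝ≥0∞) := by
    exact_mod_cast lt_add_one x
  exact h3.trans_le (le_iInf fun u => le_iInf fun v => le_iInf fun hvu => (hr u v hvu).le)

theorem tendsto_zero_of_forall_le_add {a b : ℕ → ℝ≥0∞} {c : ℝ → ℝ≥0∞}
    (hb : Tendsto b atTop (𝓝 0)) (hc : Tendsto c atTop (𝓝 0))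
    (h : ∀ M, 0 < M → ∀ᶠ r in atTop, a r ≤ b r + c M) : Tendsto a atTop (𝓝 0) := by
  rw [ENNReal.tendsto_nhds_zero] at hb hc ⊢
  intro ε hε
  have hε2 : 0 < ε / 2 := ENNReal.half_pos hε.ne'
  obtain ⟨M, hM, hM0⟩ := ((hc _ hε2).and (eventually_gt_atTop 0)).exists
  filter_upwards [hb _ hε2, h M hM0] with r h1 h2
  exact h2.trans ((add_le_add h1 hM).trans (ENNReal.add_halves ε).le)

theorem tendsto_mul_ofReal_div {κ : ℝ≥0∞} (hκ : κ ≠ ⊤) (C : ℝ) :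
    Tendsto (fun M : ℝ => κ * ENNReal.ofReal (C / (16 / 25 * M))) atTop (𝓝 0) := by
  have h1 : Tendsto (fun M : ℝ => C / (16 / 25 * M)) atTop (𝓝 0) :=
    tendsto_const_nhds.div_atTop (tendsto_id.const_mul_atTop (by norm_num))
  have h2 := ENNReal.Tendsto.const_mul (a := κ) (ENNReal.tendsto_ofReal h1) (Or.inr hκ)
  simpa using h2

variable {α B s : ℕ → ℝ≥0∞} {κ : ℝ≥0∞} {n : ℕ → ℕ} {C : ℝ}

/-- If the tail is of order `1 / L`, a diverging separation makes the label errors vanish. -/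
theorem tendsto_label_error (hκ : κ ≠ ⊤) (hB : Tendsto B atTop (𝓝 0))
    (hs : Tendsto s atTop (𝓝 ⊤))
    (h : ∀ r L, 0 < L → ENNReal.ofReal L ≤ s r →
      α r ≤ B r + κ * ENNReal.ofReal (C / (16 / 25 * L))) : Tendsto α atTop (𝓝 0) := by
  refine tendsto_zero_of_forall_le_add hB (tendsto_mul_ofReal_div hκ C) fun M hM => ?_
  filter_upwards [ENNReal.tendsto_nhds_top_iff_nnreal.1 hs M.toNNReal] with r hr
  exact h r M hM hr.le

/-- If the tail is of order `1 / L`, a separation of larger order than `n` makes the expected number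
of wrong labels vanish. -/
theorem tendsto_mul_label_error_of_polynomial (hn : Tendsto n atTop atTop) (hκ : κ ≠ ⊤)
    (hB : Tendsto (fun r => (n r : ℝ≥0∞) * B r) atTop (𝓝 0))
    (hs : Tendsto (fun r => s r / (n r : ℝ≥0∞)) atTop (𝓝 ⊤))
    (h : ∀ r L, 0 < L → ENNReal.ofReal L ≤ s r →
      α r ≤ B r + κ * ENNReal.ofReal (C / (16 / 25 * L))) :
    Tendsto (fun r => (n r : ℝ≥0∞) * α r) atTop (𝓝 0) := by
  refine tendsto_zero_of_forall_le_add hB (tendsto_mul_ofReal_div hκ C) fun M hM => ?_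
  filter_upwards [ENNReal.tendsto_nhds_top_iff_nnreal.1 hs M.toNNReal,
    hn.eventually_gt_atTop 0] with r hr hnr
  have hn0 : (0 : ℝ) < n r := Nat.cast_pos.2 hnr
  have h1 : ENNReal.ofReal (M * n r) ≤ s r := by
    rw [ENNReal.ofReal_mul hM.le, ENNReal.ofReal_natCast]
    exact ENNReal.mul_le_of_le_div hr.le
  calc (n r : ℝ≥0∞) * α r
      ≤ n r * (B r + κ * ENNReal.ofReal (C / (16 / 25 * (M * n r)))) := by
        gcongr
        exact h r _ (by positivity) h1
    _ = n r * B r + κ * (ENNReal.ofReal (n r) * ENNReal.ofReal (C / (16 / 25 * (M * n r)))) := by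
        rw [ENNReal.ofReal_natCast]
        ring
    _ = n r * B r + κ * ENNReal.ofReal (C / (16 / 25 * M)) := by
        rw [← ENNReal.ofReal_mul hn0.le]
        congr 3
        field_simp

/-- If the tail is exponential, a separation of larger order than `log n` makes the expected number
of wrong labels vanish. -/
theorem tendsto_mul_label_error_of_exponential (hn : Tendsto n atTop atTop) (hκ : κ ≠ ⊤)
    (hC : 0 < C) (hB : Tendsto (fun r => (n r : ℝ≥0∞) * B r) atTop (𝓝 0))
    (hs : Tendsto (fun r => s r / ENNReal.ofReal (Real.log (n r))) atTop (𝓝 ⊤))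
    (h : ∀ r L, 0 < L → ENNReal.ofReal L ≤ s r →
      α r ≤ B r + κ * ENNReal.ofReal (Real.exp (-(C * (16 / 25 * L))))) :
    Tendsto (fun r => (n r : ℝ≥0∞) * α r) atTop (𝓝 0) := by
  have hlim : Tendsto (fun r => (n r : ℝ≥0∞) * B r + κ * ENNReal.ofReal ((n r : ℝ)⁻¹)) atTop
      (𝓝 0) := by
    have h1 : Tendsto (fun r => ((n r : ℝ))⁻¹) atTop (𝓝 0) :=
      tendsto_inv_atTop_zero.comp (tendsto_natCast_atTop_atTop.comp hn)
    have h2 := ENNReal.Tendsto.const_mul (a := κ) (ENNReal.tendsto_ofReal h1) (Or.inr hκ)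
    simpa using hB.add h2
  -- With `L = M log n` for this `M` the tail is `n⁻²`.
  set M : ℝ := 25 / (8 * C) with hM
  have hM0 : 0 < M := by positivity
  refine tendsto_of_tendsto_of_tendsto_of_le_of_le' tendsto_const_nhds hlim
    (Eventually.of_forall fun _ => zero_le) ?_
  filter_upwards [ENNReal.tendsto_nhds_top_iff_nnreal.1 hs M.toNNReal,
    hn.eventually_gt_atTop 1] with r hr hnr
  have hn1 : (1 : ℝ) < n r := Nat.one_lt_cast.2 hnr
  have hlog : 0 < Real.log (n r) := Real.log_pos hn1
  have h1 : ENNReal.ofReal (M * Real.log (n r)) ≤ s r := by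
    rw [ENNReal.ofReal_mul hM0.le]
    exact ENNReal.mul_le_of_le_div hr.le
  calc (n r : ℝ≥0∞) * α r
      ≤ n r * (B r + κ * ENNReal.ofReal
          (Real.exp (-(C * (16 / 25 * (M * Real.log (n r))))))) := by
        gcongr
        exact h r _ (by positivity) h1
    _ = n r * B r + κ * (ENNReal.ofReal (n r) * ENNReal.ofReal
          (Real.exp (-(C * (16 / 25 * (M * Real.log (n r))))))) := by
        rw [ENNReal.ofReal_natCast]
        ring
    _ = n r * B r + κ * ENNReal.ofReal ((n r : ℝ)⁻¹) := by
        rw [← ENNReal.ofReal_mul (by positivity)]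
        congr 3
        have h2 : -(C * (16 / 25 * (M * Real.log (n r)))) =
            -Real.log (n r) + -Real.log (n r) := by
          rw [hM]
          field_simp
          ring
        rw [h2, Real.exp_add, Real.exp_neg, Real.exp_log (by linarith)]
        field_simp

end Rates

theorem tendstoInDistribution_of_measure_ne {Ω : Type*} [MeasurableSpace Ω] {Q : Measure Ω}
    [IsProbabilityMeasure Q] {f g : ℕ → Ω → ℝ} {ν : Measure ℝ} [IsProbabilityMeasure ν]
    (hf : TendstoInDistribution f atTop id (fun _ => Q) ν) (hg : ∀ r, AEMeasurable (g r) Q)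
    (hfg : Tendsto (fun r => Q {ω | g r ω ≠ f r ω}) atTop (𝓝 0)) :
    TendstoInDistribution g atTop id (fun _ => Q) ν :=
  tendstoInDistribution_of_tendstoInMeasure_sub g id hf
    (tendstoInMeasure_zero_of_measure_ne (by simpa [sub_ne_zero] using hfg)) hg

end SubstituteAdjustment

open SubstituteAdjustment in
theorem theorem2
    {Ω₀ Ω : Type*} [MeasurableSpace Ω₀] [MeasurableSpace Ω]
    (P : Measure Ω₀) [IsProbabilityMeasure P] (Q : Measure Ω) [IsProbabilityMeasure Q]
    {K : ℕ} (X : ℕ → Ω₀ → ℝ) (Z : Ω₀ → Fin K) (Y : Ω₀ → ℝ)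
    (hmix : IsMixtureModel P X Z) (hY : MemLp Y 2 P)
    (sel : (Fin K → ℝ) → Fin K) (hsel : IsArgminRule sel)
    (est : ∀ m p : ℕ, (Fin m → Fin p → ℝ) → Fin K → Fin p → ℝ)
    (hest : ∀ m p, Measurable (est m p))
    (n m p : ℕ → ℕ)
    (hn : Tendsto n atTop atTop) (hm : Tendsto m atTop atTop) (hp : Tendsto p atTop atTop)
    (i : ℕ) (hi : ∀ r, i < p r)
    (xs₀ : ∀ r, Fin (m r) → Ω → Fin (p r) → ℝ) (xs : ∀ r, Fin (n r) → Ω → Fin (p r) → ℝ)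
    (z : ∀ r, Fin (n r) → Ω → Fin K) (y : ∀ r, Fin (n r) → Ω → ℝ)
    (hdata : ∀ r, IsData P X Z Y Q (n r) (m r) (p r) (xs₀ r) (xs r) (z r) (y r))
    (muCheck : ∀ r, Ω → Fin K → Fin (p r) → ℝ)
    (hmuCheck : ∀ r ω, muCheck r ω = est (m r) (p r) (fun k => xs₀ r k ω))
    (bSub bOracle : ℕ → Ω → ℝ)
    (hbSub : ∀ r ω, bSub r ω =
      betaSub sel (muCheck r ω) (fun k => xs r k ω) (fun k => y r k ω) ⟨i, hi r⟩)
    (hbOracle : ∀ r ω, bOracle r ω =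
      betaOracle (fun k => z r k ω) (fun k => xs r k ω) (fun k => y r k ω) ⟨i, hi r⟩)
    (badProb : ℕ → Fin K → Fin K → ℝ≥0∞)
    (hbadProb : ∀ r u v, badProb r u v =
      Q {ω | 1 / 10 < relError (meanVec P X Z (p r)) (muCheck r ω) u v})
    (hbad : ∀ u v, v ≠ u → Tendsto (fun r => badProb r u v) atTop (𝓝 0)) :
    (TendstoInMeasure Q (fun r ω => |bSub r ω - bOracle r ω|) atTop (fun _ => 0) ∧
      TendstoInMeasure Q bSub atTop (fun _ => targetBeta P X Z Y i)) ∧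
    ((∀ u v, v ≠ u → Tendsto (fun r => (n r : ℝ≥0∞) * badProb r u v) atTop (𝓝 0)) →
      (Tendsto (fun r => sep P X Z (p r) / (n r : ℝ≥0∞)) atTop (𝓝 ⊤) ∨
        (IsUniformlySubGaussian P X Z ∧
          Tendsto (fun r => sep P X Z (p r) / ENNReal.ofReal (Real.log (n r))) atTop (𝓝 ⊤))) →
      TendstoInMeasure Q (fun r ω => √(n r) * |bSub r ω - bOracle r ω|) atTop (fun _ => 0) ∧
      (∀ w2 : ℝ≥0,
        TendstoInDistribution (fun r ω => √(n r) * (bOracle r ω - targetBeta P X Z Y i)) atTop id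
            (fun _ => Q) (gaussianReal 0 w2) ↔
          TendstoInDistribution (fun r ω => √(n r) * (bSub r ω - targetBeta P X Z Y i)) atTop id
            (fun _ => Q) (gaussianReal 0 w2)) ∧
      (MemLp (olsScore P X Z Y i) 2 P →
        TendstoInDistribution (fun r ω => √(n r) * (bOracle r ω - targetBeta P X Z Y i)) atTop id
            (fun _ => Q) (gaussianReal 0 (sandwichVariance P X Z Y i).toNNReal) ∧
          TendstoInDistribution (fun r ω => √(n r) * (bSub r ω - targetBeta P X Z Y i)) atTop id
            (fun _ => Q) (gaussianReal 0 (sandwichVariance P X Z Y i).toNNReal))) := by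
  have hXm := hmix.measurable_X
  have hZm := hmix.measurable_Z
  have hw := hmix.weight_pos
  have hX2 := memLp_X hmix i
  have hVpos := meanCondVariance_pos hmix i
  have hVeq : ∫ ω, cov[X i, X i; P[|Z ← Z ω]] ∂P = meanCondVariance P X Z i :=
    (meanCondVariance_eq hmix i).symm
  have hβ : ∫ ω, cov[X i, Y; P[|Z ← Z ω]] ∂P =
      targetBeta P X Z Y i * meanCondVariance P X Z i :=
    (div_mul_cancel₀ _ hVpos.ne').symm
  let u : ∀ r, Fin (n r) → Ω → ℝ × Fin K × ℝ := fun r k ω => (xs r k ω ⟨i, hi r⟩, z r k ω, y r k ω)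
  let W : Ω₀ → ℝ × Fin K × ℝ := fun ω => (X i ω, Z ω, Y ω)
  let lab : ∀ r, Fin (n r) → Ω → Fin K := fun r k ω => substitute sel (muCheck r ω) (xs r k ω)
  have hid : ∀ r k, IdentDistrib (u r k) W Q P := fun r k =>
    ((hdata r).identDistrib k).comp
      (u := fun s : (Fin (p r) → ℝ) × Fin K × ℝ => (s.1 ⟨i, hi r⟩, s.2.1, s.2.2)) (by fun_prop)
  have hind : ∀ r, iIndepFun (u r) Q := fun r =>
    (hdata r).indep.comp
      (fun _ (s : (Fin (p r) → ℝ) × Fin K × ℝ) => (s.1 ⟨i, hi r⟩, s.2.1, s.2.2))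
      (fun _ => by fun_prop)
  have hl : Measurable fun s : ℝ × Fin K × ℝ => s.2.1 := by fun_prop
  have hf : Measurable fun s : ℝ × Fin K × ℝ => s.1 := by fun_prop
  have hg : Measurable fun s : ℝ × Fin K × ℝ => s.2.2 := by fun_prop
  have hum : ∀ r k, AEMeasurable (u r k) Q := fun r k => (hid r k).aemeasurable_fst
  have hzm : ∀ r k, AEMeasurable (z r k) Q := fun r k => hl.comp_aemeasurable (hum r k)
  have hxim : ∀ r k, AEMeasurable (fun ω => xs r k ω ⟨i, hi r⟩) Q := fun r k =>
    hf.comp_aemeasurable (hum r k)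
  have hym : ∀ r k, AEMeasurable (y r k) Q := fun r k => hg.comp_aemeasurable (hum r k)
  have hlabm : ∀ r k, AEMeasurable (lab r k) Q := by
    intro r k
    have h1 : AEMeasurable (muCheck r) Q := by
      have : muCheck r = fun ω => est (m r) (p r) fun l => xs₀ r l ω := funext (hmuCheck r)
      rw [this]
      exact (hest _ _).comp_aemeasurable
        (aemeasurable_pi_lambda _ fun l => ((hdata r).identDistrib₀ l).aemeasurable_fst)
    have h2 : AEMeasurable (xs r k) Q :=
      measurable_fst.comp_aemeasurable ((hdata r).identDistrib k).aemeasurable_fst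
    exact aemeasurable_substitute hsel.1 h1 h2
  have hSub : ∀ r ω, bSub r ω = betaOLS (fun k => lab r k ω) (fun k => xs r k ω ⟨i, hi r⟩)
      (fun k => y r k ω) := hbSub
  have hOracle : ∀ r ω, bOracle r ω = betaOLS (fun k => z r k ω)
      (fun k => xs r k ω ⟨i, hi r⟩) (fun k => y r k ω) := hbOracle
  have hSubm : ∀ r, AEMeasurable (bSub r) Q := fun r =>
    (aemeasurable_betaOLS (hlabm r) (hxim r) (hym r)).congr (ae_of_all _ fun ω => (hSub r ω).symm)
  have hOraclem : ∀ r, AEMeasurable (bOracle r) Q := fun r =>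
    (aemeasurable_betaOLS (hzm r) (hxim r) (hym r)).congr (ae_of_all _ fun ω => (hOracle r ω).symm)
  set α : ℕ → ℝ≥0∞ := fun r => ⨆ k, Q {ω | lab r k ω ≠ z r k ω} with hα
  set B : ℕ → ℝ≥0∞ := fun r => ∑ a, ∑ b, if b ≠ a then badProb r a b else 0 with hB
  set κ : ℝ≥0∞ := K * K with hκ
  have hκtop : κ ≠ ⊤ := ENNReal.mul_ne_top (ENNReal.natCast_ne_top K) (ENNReal.natCast_ne_top K)
  have hαle : ∀ r k, Q {ω | lab r k ω ≠ z r k ω} ≤ α r := fun r k =>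
    le_iSup (fun k => Q {ω | lab r k ω ≠ z r k ω}) k
  have hbound : ∀ {T : ℝ → ℝ≥0∞}, IsTailBound P X Z T → ∀ r L, 0 < L →
      ENNReal.ofReal L ≤ sep P X Z (p r) → α r ≤ B r + κ * T (16 / 25 * L) := by
    intro T hT r L hL hsep
    refine iSup_le fun k => ?_
    have h1 := measure_substitute_ne_le_of_isData hmix hT hsel (hest (m r) (p r)) (hdata r)
      hL hsep k
    simpa only [← hmuCheck, ← hbadProb] using h1
  obtain ⟨C, hC, hcheb⟩ := exists_isTailBound_chebyshev hmix
  have hBlim : Tendsto B atTop (𝓝 0) := by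
    have h1 : Tendsto B atTop (𝓝 (∑ a : Fin K, ∑ b : Fin K, 0)) :=
      tendsto_finsetSum _ fun a _ => tendsto_finsetSum _ fun b _ => by
        by_cases hab : b = a
        · simp [hab]
        · simpa [hab] using hbad a b hab
    simpa using h1
  have hαlim : Tendsto α atTop (𝓝 0) :=
    tendsto_label_error hκtop hBlim (tendsto_sep hmix hp) (hbound hcheb)
  -- Consistency holds for every labelling that is wrong with vanishing probability.
  have hcons : ∀ {l' : ∀ r, Fin (n r) → Ω → Fin K}, (∀ r k, AEMeasurable (l' r k) Q) →
      (∀ r k, Q {ω | l' r k ω ≠ z r k ω} ≤ α r) → TendstoInMeasure Q (fun r ω =>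
        betaOLS (fun k => l' r k ω) (fun k => xs r k ω ⟨i, hi r⟩) (fun k => y r k ω)) atTop
        (fun _ => targetBeta P X Z Y i) := by
    intro l' hl' hαl'
    exact tendstoInMeasure_betaOLS_of_labels (u := u) (W := W) (l := fun s => s.2.1)
      (f := fun s => s.1) (g := fun s => s.2.2) hn hid hind hl hZm hw hf hg hX2 hY hVpos.ne' hVeq
      hβ hl' hαl' hαlim
  have hSublim : TendstoInMeasure Q bSub atTop (fun _ => targetBeta P X Z Y i) :=
    (hcons hlabm hαle).congr_left fun r => ae_of_all _ fun ω => (hSub r ω).symm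
  have hOraclelim : TendstoInMeasure Q bOracle atTop (fun _ => targetBeta P X Z Y i) :=
    (hcons hzm (by simp)).congr_left fun r => ae_of_all _ fun ω => (hOracle r ω).symm
  refine ⟨⟨tendstoInMeasure_abs_sub hSublim hOraclelim, hSublim⟩, fun hnbad hcase => ?_⟩
  have hnB : Tendsto (fun r => (n r : ℝ≥0∞) * B r) atTop (𝓝 0) := by
    have h1 : Tendsto (fun r => (n r : ℝ≥0∞) * B r) atTop (𝓝 (∑ a : Fin K, ∑ b : Fin K, 0)) := by
      simp only [hB, Finset.mul_sum]
      exact tendsto_finsetSum _ fun a _ => tendsto_finsetSum _ fun b _ => by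
        by_cases hab : b = a
        · simp [hab]
        · simpa [hab] using hnbad a b hab
    simpa using h1
  have hnα : Tendsto (fun r => (n r : ℝ≥0∞) * α r) atTop (𝓝 0) := by
    rcases hcase with hs | ⟨hsub, hs⟩
    · exact tendsto_mul_label_error_of_polynomial hn hκtop hnB hs (hbound hcheb)
    · obtain ⟨C', hC', hexp⟩ := exists_isTailBound_subgaussian hmix hsub
      exact tendsto_mul_label_error_of_exponential hn hκtop hC' hnB hs (hbound hexp)
  have hne : Tendsto (fun r => Q {ω | bSub r ω ≠ bOracle r ω}) atTop (𝓝 0) := by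
    refine tendsto_of_tendsto_of_tendsto_of_le_of_le tendsto_const_nhds hnα (fun _ => zero_le)
      fun r => ?_
    calc Q {ω | bSub r ω ≠ bOracle r ω} ≤ Q (⋃ k, {ω | lab r k ω ≠ z r k ω}) := by
          refine measure_mono fun ω hω => ?_
          by_contra hcon
          simp only [Set.mem_iUnion, Set.mem_ofPred_eq, not_exists, not_not] at hcon
          refine hω ?_
          rw [hSub, hOracle]
          simp only [hcon]
      _ ≤ ∑ k, Q {ω | lab r k ω ≠ z r k ω} := measure_iUnion_fintype_le _ _
      _ ≤ ∑ k : Fin (n r), α r := Finset.sum_le_sum fun k _ => hαle r k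
      _ = n r * α r := by simp
  have hscaled : ∀ (b b' : ℕ → Ω → ℝ) (r : ℕ), {ω | √(n r) * (b r ω - targetBeta P X Z Y i) ≠
      √(n r) * (b' r ω - targetBeta P X Z Y i)} ⊆ {ω | b r ω ≠ b' r ω} :=
    fun b b' r ω hω h0 => hω (by rw [h0])
  have hneSub : Tendsto (fun r => Q {ω | √(n r) * (bSub r ω - targetBeta P X Z Y i) ≠
      √(n r) * (bOracle r ω - targetBeta P X Z Y i)}) atTop (𝓝 0) :=
    tendsto_of_tendsto_of_tendsto_of_le_of_le tendsto_const_nhds hne (fun _ => zero_le)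
      fun r => measure_mono (hscaled bSub bOracle r)
  have hneOracle : Tendsto (fun r => Q {ω | √(n r) * (bOracle r ω - targetBeta P X Z Y i) ≠
      √(n r) * (bSub r ω - targetBeta P X Z Y i)}) atTop (𝓝 0) := by
    simpa only [ne_comm] using hneSub
  have hiff : ∀ w2 : ℝ≥0,
      TendstoInDistribution (fun r ω => √(n r) * (bOracle r ω - targetBeta P X Z Y i)) atTop id
          (fun _ => Q) (gaussianReal 0 w2) ↔
        TendstoInDistribution (fun r ω => √(n r) * (bSub r ω - targetBeta P X Z Y i)) atTop id
          (fun _ => Q) (gaussianReal 0 w2) := fun w2 =>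
    ⟨fun h => tendstoInDistribution_of_measure_ne h
        (fun r => ((hSubm r).sub_const _).const_mul _) hneSub,
      fun h => tendstoInDistribution_of_measure_ne h
        (fun r => ((hOraclem r).sub_const _).const_mul _) hneOracle⟩
  refine ⟨tendstoInMeasure_zero_of_measure_ne ?_, hiff, fun hscore => ?_⟩
  · refine tendsto_of_tendsto_of_tendsto_of_le_of_le tendsto_const_nhds hne (fun _ => zero_le)
      fun r => measure_mono fun ω hω h0 => hω ?_
    simp [h0]
  have hclt := tendstoInDistribution_betaOLS (u := u) (W := W) (l := fun s => s.2.1)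
    (f := fun s => s.1) (g := fun s => s.2.2) hn hid hind hl hZm hw hf hg hX2 hY
    (c := condMean P X Z i) (d := outcomeMean P Z Y) (β := targetBeta P X Z Y i) hVpos.ne'
    (fun _ => rfl) (fun _ => rfl) hVeq hβ hscore
  have hclt' : TendstoInDistribution
      (fun r ω => √(n r) * (bOracle r ω - targetBeta P X Z Y i)) atTop id
      (fun _ => Q) (gaussianReal 0 (sandwichVariance P X Z Y i).toNNReal) := by
    simp only [hOracle]
    exact hclt
  exact ⟨hclt', (hiff _).1 hclt'⟩
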